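/- Let $\bar h>0$ and let $(h,U,V)(t,r)$ satisfy the radially symmetric rotating shallow water system $$ \begin{aligned} &\partial_t h+\partial_r(hU)+\frac{hU}{r}=0,\\ &\partial_t U+U\,\partial_r U+\partial_r h-V-\frac{V^2}{r}=0,\\ &\partial_t V+U\,\partial_r V+U+\frac{VU}{r}=0, \end{aligned} \qquad r>0, $$ with initial data $(h,U,V)(0,r)=(h_0,U_0,V_0)(r)$. A classical solution on $[0,T)$ is a triple of functions that are $C^1$ on $[0,T)\times[0,\infty)$, with $U=V=0$ at $r=0$ (that is, the corresponding planar fields are $C^1$ on $[0,T)\times\mathbb R^2$), and that satisfy the system and the initial condition. For all positive constants $A,\underline h,\bar h,\underline\beta,\bar\beta$, every $B\ge 0$ and every $\epsilon\in(0,\tfrac13)$ there is a constant $C>0$, depending only on $A,\underline h,\bar h,B,\underline\beta,\bar\beta,\epsilon$, such that the following holds. Let $(h_0-\bar h,U_0,V_0)\in C_c^1((0,\infty))$ be supported in $[\underline\beta,\bar\beta]$, with $\|V_0\|_{L^\infty(0,\infty)}\le B$, with $h_0\ge\underline h$ and $U_0\le 0$ on $[\underline\beta,\bar\beta]$, and with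 $$\|U_0\|_{L^\infty(0,\infty)}\le A\,\|U_0\|_{L^1(0,\infty)},\qquad \|U_0\|_{L^\infty(0,\infty)}\ge C .$$ Then the classical solution forms a singularity in finite time, before $t=2\|U_0\|_{L^\infty}^{-1/3+\epsilon}$: if a classical solution with these data exists on $[0,T)$, then $T<2\|U_0\|_{L^\infty}^{-1/3+\epsilon}$. In particular there is no classical solution on $[0,\infty)$. -/

import Mathlib

open Set MeasureTheory
open scoped ENNReal

/-- The `L^p` norm on the half-line `(0, ∞)` with respect to `dr`. -/
noncomputable def halfLineNorm (p : ℝ≥0∞) (f : ℝ → ℝ) : ℝ :=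
  lpNorm f p (volume.restrict (Ioi 0))

/-- `(h₀ - hbar, U₀, V₀)` belongs to `C_c^1((0, ∞))` with support contained in `[β₁, β₂]`.
Values at `r ≤ 0` are irrelevant. -/
structure IsInitialData (hbar β₁ β₂ : ℝ) (h₀ U₀ V₀ : ℝ → ℝ) : Prop where
  contDiffOn_h : ContDiffOn ℝ 1 h₀ (Ioi 0)
  contDiffOn_U : ContDiffOn ℝ 1 U₀ (Ioi 0)
  contDiffOn_V : ContDiffOn ℝ 1 V₀ (Ioi 0)
  h_eq : ∀ r, 0 < r → r ∉ Icc β₁ β₂ → h₀ r = hbar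
  U_eq : ∀ r, 0 < r → r ∉ Icc β₁ β₂ → U₀ r = 0
  V_eq : ∀ r, 0 < r → r ∉ Icc β₁ β₂ → V₀ r = 0

/-- `(h, U, V)`, functions of `(t, r)`, is a classical solution on the time interval `[0, T)` of the
radially symmetric rotating shallow water system with initial data `(h₀, U₀, V₀)`.

The functions are `C¹` on `[0, T) × [0, ∞)` (one-sided at the boundary) and the two velocity
components vanish at the pole `r = 0`.  This says that the planar fields
`h(t, |x|)`, `U(t, |x|) x / |x| + V(t, |x|) x^⊥ / |x|` are `C¹` on `[0, T) × ℝ²`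
(for a solution, `∂h/∂r = 0` at `r = 0` then follows from the second equation). -/
structure IsClassicalSolution (T : ℝ) (h₀ U₀ V₀ : ℝ → ℝ) (h U V : ℝ → ℝ → ℝ) : Prop where
  contDiffOn_h : ContDiffOn ℝ 1 (fun p : ℝ × ℝ => h p.1 p.2) (Ico 0 T ×ˢ Ici 0)
  contDiffOn_U : ContDiffOn ℝ 1 (fun p : ℝ × ℝ => U p.1 p.2) (Ico 0 T ×ˢ Ici 0)
  contDiffOn_V : ContDiffOn ℝ 1 (fun p : ℝ × ℝ => V p.1 p.2) (Ico 0 T ×ˢ Ici 0)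
  U_pole : ∀ t ∈ Ico 0 T, U t 0 = 0
  V_pole : ∀ t ∈ Ico 0 T, V t 0 = 0
  mass : ∀ t ∈ Ioo 0 T, ∀ r, 0 < r →
    deriv (fun s => h s r) t + deriv (fun x => h t x * U t x) r + h t r * U t r / r = 0
  radial_momentum : ∀ t ∈ Ioo 0 T, ∀ r, 0 < r →
    deriv (fun s => U s r) t + U t r * deriv (fun x => U t x) r + deriv (fun x => h t x) r
      - V t r - V t r ^ 2 / r = 0
  angular_momentum : ∀ t ∈ Ioo 0 T, ∀ r, 0 < r →
    deriv (fun s => V s r) t + U t r * deriv (fun x => V t x) r + U t r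
      + V t r * U t r / r = 0
  initial_h : ∀ r, 0 < r → h 0 r = h₀ r
  initial_U : ∀ r, 0 < r → U 0 r = U₀ r
  initial_V : ∀ r, 0 < r → V 0 r = V₀ r

/-! The speed of sound ahead of the wave is fixed by the rest state, so for a short time the
solution stays at rest at one radius `a` inside and one radius `b` outside the support. On `[a, b]`
nothing crosses the boundary: the mass `m = ∫ r h` is constant, `h` stays nonnegative, and the
absolute angular momentum keeps its initial bound.

The initial height has no upper bound, hence neither has `m`, and two functionals are used. Put `M =
‖U₀‖_∞`, `x = M ^ (1/3)`, `y = M ^ ε`. If `m ≤ x²`, the inward momentum `F = -∫ h U` satisfies `F' ≥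
F² / m - K m`, with `F(0)` at least of order `M = x³`; its lifespan is of order `m / F(0) ≲ 1 / x`.
If `m ≥ x²`, the pressure alone suffices: `J = ∫ r² h U` satisfies `J' ≥ J² / (b² m) + m² / (2 b²)`,
so whatever `J(0)` is, the lifespan is of order `b² / √m ≲ 1 / x`. The threshold `x²` balances the
two times, whence the exponent `-1/3`; the factor `y` absorbs all constants. The cases meet in
`IsRotatingShallowWater.lifespan_le`; localization is `rest_of_rest_initially`. -/

/-! ### Calculus of `C¹` functions of time and radius -/

/-- `f` is continuously differentiable on `[0, T) × (0, ∞)`, with partial derivatives `ft`, `fr`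
in the interior that extend continuously to `t = 0`. -/
structure HasC1Derivs (T : ℝ) (f ft fr : ℝ → ℝ → ℝ) : Prop where
  cont : ContinuousOn (fun p : ℝ × ℝ => f p.1 p.2) (Ico 0 T ×ˢ Ioi 0)
  cont_t : ContinuousOn (fun p : ℝ × ℝ => ft p.1 p.2) (Ico 0 T ×ˢ Ioi 0)
  cont_r : ContinuousOn (fun p : ℝ × ℝ => fr p.1 p.2) (Ico 0 T ×ˢ Ioi 0)
  dt : ∀ t ∈ Ioo 0 T, ∀ r, 0 < r → HasDerivAt (fun s => f s r) (ft t r) t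
  dr : ∀ t ∈ Ioo 0 T, ∀ r, 0 < r → HasDerivAt (fun x => f t x) (fr t r) r

namespace HasC1Derivs

variable {T : ℝ} {f ft fr g gt gr : ℝ → ℝ → ℝ}

theorem of_contDiffOn
    (hf : ContDiffOn ℝ 1 (fun p : ℝ × ℝ => f p.1 p.2) (Ico 0 T ×ˢ Ici 0)) :
    ∃ ft fr, HasC1Derivs T f ft fr := by
  set F : ℝ × ℝ → ℝ := fun p => f p.1 p.2 with hF
  set S : Set (ℝ × ℝ) := Ico 0 T ×ˢ Ici 0 with hS
  have hsub : Ico 0 T ×ˢ Ioi (0 : ℝ) ⊆ S := prod_mono subset_rfl Ioi_subset_Ici_self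
  -- Unique differentiability of `S` makes `fderivWithin` continuous up to `t = 0`; at interior
  -- points it is the full derivative.
  have hu : UniqueDiffOn ℝ S := (uniqueDiffOn_Ico 0 T).prod (uniqueDiffOn_Ici 0)
  have hc := (hf.continuousOn_fderivWithin hu le_rfl).mono hsub
  have key : ∀ t ∈ Ioo 0 T, ∀ r, 0 < r →
      HasFDerivAt F (fderivWithin ℝ F S (t, r)) (t, r) := by
    intro t ht r hr
    have hmem : S ∈ nhds (t, r) := prod_mem_nhds (Ico_mem_nhds ht.1 ht.2) (Ici_mem_nhds hr)
    exact ((hf.differentiableOn one_ne_zero) (t, r)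
      (mem_of_mem_nhds hmem)).hasFDerivWithinAt.hasFDerivAt hmem
  refine ⟨fun t r => fderivWithin ℝ F S (t, r) (1, 0), fun t r => fderivWithin ℝ F S (t, r) (0, 1),
    hf.continuousOn.mono hsub, hc.clm_apply continuousOn_const, hc.clm_apply continuousOn_const,
    fun t ht r hr => ?_, fun t ht r hr => ?_⟩
  · exact (key t ht r hr).comp_hasDerivAt t ((hasDerivAt_id t).prodMk (hasDerivAt_const t r))
  · exact (key t ht r hr).comp_hasDerivAt r ((hasDerivAt_const r t).prodMk (hasDerivAt_id r))

theorem const (c : ℝ) : HasC1Derivs T (fun _ _ => c) (fun _ _ => 0) (fun _ _ => 0) :=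
  ⟨continuousOn_const, continuousOn_const, continuousOn_const,
    fun t _ _ _ => hasDerivAt_const t c, fun _ _ r _ => hasDerivAt_const r c⟩

theorem time : HasC1Derivs T (fun t _ => t) (fun _ _ => 1) (fun _ _ => 0) :=
  ⟨continuousOn_fst, continuousOn_const, continuousOn_const,
    fun t _ _ _ => hasDerivAt_id t, fun t _ r _ => hasDerivAt_const r t⟩

theorem radius : HasC1Derivs T (fun _ r => r) (fun _ _ => 0) (fun _ _ => 1) :=
  ⟨continuousOn_snd, continuousOn_const, continuousOn_const,
    fun t _ r _ => hasDerivAt_const t r, fun _ _ r _ => hasDerivAt_id r⟩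

theorem add (hf : HasC1Derivs T f ft fr) (hg : HasC1Derivs T g gt gr) :
    HasC1Derivs T (fun t r => f t r + g t r) (fun t r => ft t r + gt t r)
      (fun t r => fr t r + gr t r) :=
  ⟨hf.cont.add hg.cont, hf.cont_t.add hg.cont_t, hf.cont_r.add hg.cont_r,
    fun t ht r hr => (hf.dt t ht r hr).add (hg.dt t ht r hr),
    fun t ht r hr => (hf.dr t ht r hr).add (hg.dr t ht r hr)⟩

theorem sub (hf : HasC1Derivs T f ft fr) (hg : HasC1Derivs T g gt gr) :
    HasC1Derivs T (fun t r => f t r - g t r) (fun t r => ft t r - gt t r)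
      (fun t r => fr t r - gr t r) :=
  ⟨hf.cont.sub hg.cont, hf.cont_t.sub hg.cont_t, hf.cont_r.sub hg.cont_r,
    fun t ht r hr => (hf.dt t ht r hr).sub (hg.dt t ht r hr),
    fun t ht r hr => (hf.dr t ht r hr).sub (hg.dr t ht r hr)⟩

theorem neg (hf : HasC1Derivs T f ft fr) :
    HasC1Derivs T (fun t r => -f t r) (fun t r => -ft t r) (fun t r => -fr t r) :=
  ⟨hf.cont.neg, hf.cont_t.neg, hf.cont_r.neg,
    fun t ht r hr => (hf.dt t ht r hr).neg, fun t ht r hr => (hf.dr t ht r hr).neg⟩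

theorem mul (hf : HasC1Derivs T f ft fr) (hg : HasC1Derivs T g gt gr) :
    HasC1Derivs T (fun t r => f t r * g t r) (fun t r => ft t r * g t r + f t r * gt t r)
      (fun t r => fr t r * g t r + f t r * gr t r) :=
  ⟨hf.cont.mul hg.cont, (hf.cont_t.mul hg.cont).add (hf.cont.mul hg.cont_t),
    (hf.cont_r.mul hg.cont).add (hf.cont.mul hg.cont_r),
    fun t ht r hr => (hf.dt t ht r hr).mul (hg.dt t ht r hr),
    fun t ht r hr => (hf.dr t ht r hr).mul (hg.dr t ht r hr)⟩

theorem comp {p p' : ℝ → ℝ} (hf : HasC1Derivs T f ft fr) (hp : ∀ x, HasDerivAt p (p' x) x)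
    (hp' : Continuous p') :
    HasC1Derivs T (fun t r => p (f t r)) (fun t r => p' (f t r) * ft t r)
      (fun t r => p' (f t r) * fr t r) := by
  have hpc : Continuous p := continuous_iff_continuousAt.2 fun x => (hp x).continuousAt
  exact ⟨hpc.comp_continuousOn hf.cont, (hp'.comp_continuousOn hf.cont).mul hf.cont_t,
    (hp'.comp_continuousOn hf.cont).mul hf.cont_r,
    fun t ht r hr => (hp _).comp t (hf.dt t ht r hr),
    fun t ht r hr => (hp _).comp r (hf.dr t ht r hr)⟩

end HasC1Derivs

/-! ### Integrals over a fixed radial interval and balance laws -/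

theorem ContinuousOn.slice {T a b t : ℝ} {f : ℝ → ℝ → ℝ}
    (hf : ContinuousOn (fun p : ℝ × ℝ => f p.1 p.2) (Ico 0 T ×ˢ Ioi 0)) (ha : 0 < a)
    (ht : t ∈ Ico 0 T) : ContinuousOn (f t) (Icc a b) :=
  hf.comp (f := fun r : ℝ => (t, r)) (by fun_prop) fun _ hr => ⟨ht, ha.trans_le hr.1⟩

theorem ContinuousOn.slice_intervalIntegrable {T a b t : ℝ} {f : ℝ → ℝ → ℝ}
    (hf : ContinuousOn (fun p : ℝ × ℝ => f p.1 p.2) (Ico 0 T ×ˢ Ioi 0)) (ha : 0 < a) (hab : a ≤ b)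
    (ht : t ∈ Ico 0 T) : IntervalIntegrable (f t) volume a b :=
  (hf.slice ha ht).intervalIntegrable_of_Icc hab

theorem ContinuousOn.bounded_box {T a b τ : ℝ} {f : ℝ → ℝ → ℝ}
    (hf : ContinuousOn (fun p : ℝ × ℝ => f p.1 p.2) (Ico 0 T ×ˢ Ioi 0)) (ha : 0 < a)
    (hτ : τ < T) : ∃ K, ∀ t ∈ Icc 0 τ, ∀ r ∈ Icc a b, |f t r| ≤ K := by
  obtain ⟨K, hK⟩ := (isCompact_Icc (a := (0 : ℝ)) (b := τ)).prod
    (isCompact_Icc (a := a) (b := b)) |>.exists_bound_of_continuousOn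
    (hf.mono (prod_mono (Icc_subset_Ico_right hτ) fun _ hr => ha.trans_le hr.1))
  exact ⟨K, fun t ht r hr => hK (t, r) ⟨ht, hr⟩⟩

theorem ContinuousOn.integral_slice {T a b τ : ℝ} {f : ℝ → ℝ → ℝ}
    (hf : ContinuousOn (fun p : ℝ × ℝ => f p.1 p.2) (Ico 0 T ×ˢ Ioi 0)) (ha : 0 < a) (hab : a ≤ b)
    (hτ : τ < T) : ContinuousOn (fun t => ∫ r in a..b, f t r) (Icc 0 τ) := by
  rcases lt_or_ge τ 0 with h0 | h0
  · simp [Icc_eq_empty h0.not_ge]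
  -- Composing with the projections onto `[0, τ]` and `[a, b]` extends `f` continuously to the whole
  -- plane without changing it on the box.
  have hc : Continuous fun p : ℝ × ℝ =>
      f (projIcc 0 τ h0 p.1 : ℝ) (projIcc a b hab p.2 : ℝ) := by
    refine hf.comp_continuous (f := fun p : ℝ × ℝ =>
      ((projIcc 0 τ h0 p.1 : ℝ), (projIcc a b hab p.2 : ℝ))) ?_ ?_
    · exact (continuous_subtype_val.comp (continuous_projIcc.comp continuous_fst)).prodMk
        (continuous_subtype_val.comp (continuous_projIcc.comp continuous_snd))
    · intro p
      exact ⟨⟨(projIcc 0 τ h0 p.1).2.1, (projIcc 0 τ h0 p.1).2.2.trans_lt hτ⟩,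
        ha.trans_le (projIcc a b hab p.2).2.1⟩
  have := (intervalIntegral.continuous_parametric_intervalIntegral_of_continuous'
    (μ := volume) (f := fun t r => f (projIcc 0 τ h0 t : ℝ) (projIcc a b hab r : ℝ)) hc a b)
  refine this.continuousOn.congr fun t ht => ?_
  refine intervalIntegral.integral_congr fun r hr => ?_
  rw [uIcc_of_le hab] at hr
  simp only [projIcc_of_mem h0 ht, projIcc_of_mem hab hr]

theorem HasC1Derivs.slice {T a b t : ℝ} {f ft fr : ℝ → ℝ → ℝ} (hf : HasC1Derivs T f ft fr)
    (ha : 0 < a) (ht : t ∈ Ico 0 T) : ContinuousOn (f t) (Icc a b) :=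
  hf.cont.slice ha ht

theorem HasC1Derivs.integral_slice {T a b τ : ℝ} {f ft fr : ℝ → ℝ → ℝ}
    (hf : HasC1Derivs T f ft fr) (ha : 0 < a) (hab : a ≤ b) (hτ : τ < T) :
    ContinuousOn (fun t => ∫ r in a..b, f t r) (Icc 0 τ) :=
  hf.cont.integral_slice ha hab hτ

theorem HasC1Derivs.hasDerivAt_integral {T a b t : ℝ} {q qt qr : ℝ → ℝ → ℝ}
    (hq : HasC1Derivs T q qt qr) (ha : 0 < a) (hab : a ≤ b) (ht : t ∈ Ioo 0 T) :
    HasDerivAt (fun s => ∫ r in a..b, q s r) (∫ r in a..b, qt t r) t := by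
  obtain ⟨τ, h1, h2⟩ := exists_between ht.2
  obtain ⟨K, hK⟩ := hq.cont_t.bounded_box (b := b) ha h2
  have hnhds : Ioo 0 τ ∈ nhds t := Ioo_mem_nhds ht.1 h1
  refine (intervalIntegral.hasDerivAt_integral_of_dominated_loc_of_deriv_le
    (bound := fun _ => K) (F' := qt) hnhds ?_ ?_ ?_ ?_ ?_ ?_).2
  · filter_upwards [hnhds] with s hs
    exact (hq.cont.slice_intervalIntegrable ha hab
      ⟨hs.1.le, hs.2.trans h2⟩).def'.aestronglyMeasurable
  · exact hq.cont.slice_intervalIntegrable ha hab ⟨ht.1.le, ht.2⟩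
  · exact (hq.cont_t.slice_intervalIntegrable ha hab ⟨ht.1.le, ht.2⟩).def'.aestronglyMeasurable
  · refine Filter.Eventually.of_forall fun r hr s hs => ?_
    rw [uIoc_of_le hab] at hr
    exact hK s (Ioo_subset_Icc_self hs) r (Ioc_subset_Icc_self hr)
  · exact intervalIntegrable_const
  · refine Filter.Eventually.of_forall fun r hr s hs => ?_
    rw [uIoc_of_le hab] at hr
    exact hq.dt s ⟨hs.1, hs.2.trans h2⟩ r (ha.trans hr.1)

/-- Integrated balance law `∂ₜ q + ∂ᵣ f = g`. -/
theorem HasC1Derivs.hasDerivAt_integral_of_balance {T a b t : ℝ} {q qt qr f ft fr : ℝ → ℝ → ℝ}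
    {g : ℝ → ℝ} (hq : HasC1Derivs T q qt qr) (hf : HasC1Derivs T f ft fr) (ha : 0 < a) (hab : a ≤ b)
    (ht : t ∈ Ioo 0 T) (hg : ∀ r ∈ Icc a b, qt t r + fr t r = g r) :
    HasDerivAt (fun s => ∫ r in a..b, q s r) ((∫ r in a..b, g r) - (f t b - f t a)) t := by
  have ht' := Ioo_subset_Ico_self ht
  have h1 : ∫ r in a..b, fr t r = f t b - f t a := by
    refine intervalIntegral.integral_eq_sub_of_hasDerivAt (fun r hr => ?_)
      (hf.cont_r.slice_intervalIntegrable ha hab ht')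
    rw [uIcc_of_le hab] at hr
    exact hf.dr t ht r (ha.trans_le hr.1)
  have h2 : ∫ r in a..b, g r = (∫ r in a..b, qt t r) + ∫ r in a..b, fr t r := by
    rw [← intervalIntegral.integral_add (hq.cont_t.slice_intervalIntegrable ha hab ht')
      (hf.cont_r.slice_intervalIntegrable ha hab ht')]
    refine intervalIntegral.integral_congr fun r hr => ?_
    rw [uIcc_of_le hab] at hr
    exact (hg r hr).symm
  have := hq.hasDerivAt_integral ha hab ht
  rwa [h2, h1, add_sub_cancel_right]

/-! ### Elementary one-variable inequalities -/

/-- Squaring makes the positive part `C¹`. It serves both as the energy density in the maximum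
principle and as the moving cutoff in the domain of dependence. -/
theorem hasDerivAt_max_zero_sq (x : ℝ) :
    HasDerivAt (fun x : ℝ => max x 0 ^ 2) (2 * max x 0) x := by
  rcases lt_trichotomy x 0 with h | rfl | h
  · rw [max_eq_right h.le, mul_zero]
    refine (hasDerivAt_const x (0 : ℝ)).congr_of_eventuallyEq ?_
    filter_upwards [Iio_mem_nhds h] with y hy
    simp [max_eq_right (le_of_lt (mem_Iio.1 hy))]
  · rw [max_self, mul_zero]
    refine HasDerivAt.of_isLittleO ?_
    have : (fun x : ℝ => max x 0 ^ 2) =O[nhds 0] fun x => x ^ 2 := by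
      refine Asymptotics.IsBigO.of_bound 1 (Filter.Eventually.of_forall fun y => ?_)
      rw [one_mul, Real.norm_eq_abs, Real.norm_eq_abs, abs_of_nonneg (sq_nonneg _),
        abs_of_nonneg (sq_nonneg _)]
      rcases le_total y 0 with hy | hy
      · simp [max_eq_right hy, sq_nonneg]
      · rw [max_eq_left hy]
    simpa using this.trans_isLittleO (Asymptotics.isLittleO_pow_id (𝕜 := ℝ) one_lt_two)
  · rw [max_eq_left h.le]
    have := hasDerivAt_pow 2 x
    simp only [Nat.cast_ofNat, Nat.add_one_sub_one, pow_one] at this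
    refine this.congr_of_eventuallyEq ?_
    filter_upwards [Ioi_mem_nhds h] with y hy
    simp [max_eq_left (le_of_lt (mem_Ioi.1 hy))]

theorem HasC1Derivs.max_zero_sq {T : ℝ} {f ft fr : ℝ → ℝ → ℝ} (hf : HasC1Derivs T f ft fr) :
    HasC1Derivs T (fun t r => max (f t r) 0 ^ 2) (fun t r => 2 * max (f t r) 0 * ft t r)
      (fun t r => 2 * max (f t r) 0 * fr t r) :=
  hf.comp hasDerivAt_max_zero_sq (by fun_prop)

theorem mul_le_sub_of_le_deriv {y y' : ℝ → ℝ} {t₀ t₁ c : ℝ} (h01 : t₀ ≤ t₁)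
    (hy : ContinuousOn y (Icc t₀ t₁)) (hy' : ∀ t ∈ Ioo t₀ t₁, HasDerivAt y (y' t) t)
    (hc : ∀ t ∈ Ioo t₀ t₁, c ≤ y' t) : c * (t₁ - t₀) ≤ y t₁ - y t₀ :=
  (convex_Icc t₀ t₁).mul_sub_le_image_sub_of_le_deriv hy
    (by rw [interior_Icc]; exact fun t ht => (hy' t ht).differentiableAt.differentiableWithinAt)
    (C := c) (by rw [interior_Icc]; exact fun t ht => (hy' t ht).deriv ▸ hc t ht)
    t₀ (left_mem_Icc.2 h01) t₁ (right_mem_Icc.2 h01) h01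

/-- Grönwall's inequality with vanishing initial value. -/
theorem nonpos_of_deriv_le_mul {y y' : ℝ → ℝ} {τ K : ℝ} (hτ : 0 ≤ τ)
    (hy : ContinuousOn y (Icc 0 τ)) (hy' : ∀ t ∈ Ioo 0 τ, HasDerivAt y (y' t) t)
    (hK : ∀ t ∈ Ioo 0 τ, y' t ≤ K * y t) (h0 : y 0 ≤ 0) : y τ ≤ 0 := by
  -- Integrating factor: `exp (-K t) * y t` is nonincreasing.
  have h := mul_le_sub_of_le_deriv (y := fun t => -(Real.exp (-K * t) * y t)) (c := 0)
    (y' := fun t => -(Real.exp (-K * t) * (-K) * y t + Real.exp (-K * t) * y' t)) hτ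
    (by fun_prop)
    (fun t ht => by
      have : HasDerivAt (fun t : ℝ => Real.exp (-K * t)) (Real.exp (-K * t) * (-K)) t := by
        simpa using ((hasDerivAt_id t).const_mul (-K)).exp
      exact (this.mul (hy' t ht)).neg)
    (fun t ht => by nlinarith [hK t ht, Real.exp_pos (-K * t)])
  have h2 : Real.exp (-K * τ) * y τ ≤ 0 := by
    simp at h
    simp only [neg_mul]
    linarith
  exact nonpos_of_mul_nonpos_right h2 (Real.exp_pos _)

theorem eqOn_zero_of_integral_nonpos {a b : ℝ} {f : ℝ → ℝ} (hab : a < b)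
    (hf : ContinuousOn f (Icc a b)) (h0 : ∀ r ∈ Icc a b, 0 ≤ f r)
    (hI : ∫ r in a..b, f r ≤ 0) : ∀ r ∈ Icc a b, f r = 0 := by
  intro r hr
  by_contra hne
  exact hI.not_gt (intervalIntegral.integral_pos hab hf
    (fun x hx => h0 x (Ioc_subset_Icc_self hx)) ⟨r, hr, (h0 r hr).lt_of_ne' hne⟩)

/-! ### Transport: positivity of the height, bound on the angular momentum -/

/-- The maximum principle for the transport equation `∂ₜ w + U ∂ᵣ w + c w = 0` between two
stagnation points of `U`. -/
theorem HasC1Derivs.nonpos_of_transport {T a b τ : ℝ} {w wt wr U Ut Ur c : ℝ → ℝ → ℝ}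
    (hw : HasC1Derivs T w wt wr) (hU : HasC1Derivs T U Ut Ur)
    (hc : ContinuousOn (fun p : ℝ × ℝ => c p.1 p.2) (Ico 0 T ×ˢ Ioi 0))
    (ha : 0 < a) (hab : a < b) (hτ : τ < T)
    (heq : ∀ t ∈ Ioo 0 T, ∀ r, 0 < r → wt t r + U t r * wr t r + c t r * w t r = 0)
    (hUa : ∀ t ∈ Icc 0 τ, U t a = 0) (hUb : ∀ t ∈ Icc 0 τ, U t b = 0)
    (h0 : ∀ r ∈ Icc a b, w 0 r ≤ 0) : ∀ t ∈ Icc 0 τ, ∀ r ∈ Icc a b, w t r ≤ 0 := by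
  intro t₁ ht₁
  have ht₁T : t₁ < T := ht₁.2.trans_lt hτ
  have hq := hw.max_zero_sq
  obtain ⟨K, hK⟩ := ((hU.cont_r.sub (hc.const_smul (2 : ℝ)))).bounded_box
    (f := fun t r => Ur t r - 2 * c t r) (b := b) ha hτ
  -- With `w₊` the positive part, `∂ₜ w₊² + ∂ᵣ (U w₊²) = (∂ᵣ U - 2 c) w₊²`. The flux vanishes at `a`
  -- and `b`, so Grönwall applies to `∫ w₊²`.
  have hE : ∫ r in a..b, max (w t₁ r) 0 ^ 2 ≤ 0 := by
    refine nonpos_of_deriv_le_mul (y := fun t => ∫ r in a..b, max (w t r) 0 ^ 2)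
      (y' := fun t => (∫ r in a..b, (Ur t r - 2 * c t r) * max (w t r) 0 ^ 2)
        - (U t b * max (w t b) 0 ^ 2 - U t a * max (w t a) 0 ^ 2)) (K := K) ht₁.1
      (hq.integral_slice ha hab.le ht₁T) (fun t ht => ?_) (fun t ht => ?_) ?_
    · have htT : t ∈ Ioo 0 T := ⟨ht.1, ht.2.trans ht₁T⟩
      refine hq.hasDerivAt_integral_of_balance
        (g := fun r => (Ur t r - 2 * c t r) * max (w t r) 0 ^ 2) (hU.mul hq) ha hab.le htT fun r hr => ?_
      have h1 := heq t htT r (ha.trans_le hr.1)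
      have h2 : max (w t r) 0 * w t r = max (w t r) 0 ^ 2 := by
        rcases le_total (w t r) 0 with h | h
        · simp [max_eq_right h]
        · rw [max_eq_left h, sq]
      linear_combination 2 * max (w t r) 0 * h1 - 2 * c t r * h2
    · have htτ : t ∈ Icc 0 τ := ⟨ht.1.le, ht.2.le.trans ht₁.2⟩
      have htT : t ∈ Ico 0 T := ⟨ht.1.le, ht.2.trans ht₁T⟩
      simp only [hUa t htτ, hUb t htτ, zero_mul, sub_zero]
      rw [← intervalIntegral.integral_const_mul]
      refine intervalIntegral.integral_mono_on hab.le ?_ ?_ fun r hr => ?_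
      · refine ContinuousOn.intervalIntegrable_of_Icc hab.le ?_
        exact ((hU.cont_r.slice ha htT).sub ((hc.slice ha htT).const_smul (2 : ℝ))).mul
          (hq.slice ha htT)
      · exact ((hq.slice ha htT).const_smul K).intervalIntegrable_of_Icc hab.le
      · exact mul_le_mul_of_nonneg_right ((le_abs_self _).trans (hK t htτ r hr)) (sq_nonneg _)
    · refine (intervalIntegral.integral_congr (g := fun _ => (0 : ℝ)) fun r hr => ?_).trans_le
        (by simp)
      rw [uIcc_of_le hab.le] at hr
      simp [max_eq_right (h0 r hr)]
  intro r hr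
  have := eqOn_zero_of_integral_nonpos hab (hq.slice ha ⟨ht₁.1, ht₁T⟩)
    (fun r _ => sq_nonneg _) hE r hr
  exact (le_max_left _ _).trans_eq (pow_eq_zero_iff two_ne_zero |>.1 this)

/-- The radially symmetric rotating shallow water system on `(0, T) × (0, ∞)` for functions with
named partial derivatives. -/
structure IsRotatingShallowWater (T : ℝ) (h ht hr U Ut Ur V Vt Vr : ℝ → ℝ → ℝ) : Prop where
  c1_h : HasC1Derivs T h ht hr
  c1_U : HasC1Derivs T U Ut Ur
  c1_V : HasC1Derivs T V Vt Vr
  mass : ∀ t ∈ Ioo 0 T, ∀ r, 0 < r →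
    ht t r + (hr t r * U t r + h t r * Ur t r) + h t r * U t r / r = 0
  radial : ∀ t ∈ Ioo 0 T, ∀ r, 0 < r →
    Ut t r + U t r * Ur t r + hr t r - V t r - V t r ^ 2 / r = 0
  angular : ∀ t ∈ Ioo 0 T, ∀ r, 0 < r →
    Vt t r + U t r * Vr t r + U t r + V t r * U t r / r = 0

theorem IsClassicalSolution.exists_isRotatingShallowWater {T : ℝ} {h₀ U₀ V₀ : ℝ → ℝ}
    {h U V : ℝ → ℝ → ℝ} (hs : IsClassicalSolution T h₀ U₀ V₀ h U V) :
    ∃ ht hr Ut Ur Vt Vr, IsRotatingShallowWater T h ht hr U Ut Ur V Vt Vr := by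
  obtain ⟨ht, hr, hh⟩ := HasC1Derivs.of_contDiffOn hs.contDiffOn_h
  obtain ⟨Ut, Ur, hU⟩ := HasC1Derivs.of_contDiffOn hs.contDiffOn_U
  obtain ⟨Vt, Vr, hV⟩ := HasC1Derivs.of_contDiffOn hs.contDiffOn_V
  refine ⟨ht, hr, Ut, Ur, Vt, Vr, hh, hU, hV, fun t htT r hr0 => ?_, fun t htT r hr0 => ?_,
    fun t htT r hr0 => ?_⟩
  · have := hs.mass t htT r hr0
    have h' := ((hh.mul hU).dr t htT r hr0).deriv
    rwa [(hh.dt t htT r hr0).deriv, h'] at this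
  · have := hs.radial_momentum t htT r hr0
    rwa [(hU.dt t htT r hr0).deriv, (hU.dr t htT r hr0).deriv, (hh.dr t htT r hr0).deriv] at this
  · have := hs.angular_momentum t htT r hr0
    rwa [(hV.dt t htT r hr0).deriv, (hV.dr t htT r hr0).deriv] at this

namespace IsRotatingShallowWater

variable {T : ℝ} {h ht hr U Ut Ur V Vt Vr : ℝ → ℝ → ℝ}

/-- The mass equation is a transport equation for `h` with zeroth-order coefficient `∂ᵣ U + U / r`,
so the maximum principle applies to `-h`. -/
theorem height_nonneg (hs : IsRotatingShallowWater T h ht hr U Ut Ur V Vt Vr) {a b τ : ℝ}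
    (ha : 0 < a) (hab : a < b) (hτ : τ < T)
    (hUa : ∀ t ∈ Icc 0 τ, U t a = 0) (hUb : ∀ t ∈ Icc 0 τ, U t b = 0)
    (h0 : ∀ r ∈ Icc a b, 0 ≤ h 0 r) : ∀ t ∈ Icc 0 τ, ∀ r ∈ Icc a b, 0 ≤ h t r := by
  intro t htτ r hrab
  have := hs.c1_h.neg.nonpos_of_transport hs.c1_U (c := fun t r => Ur t r + U t r / r)
    (hs.c1_U.cont_r.add (hs.c1_U.cont.div continuousOn_snd fun p hp => ne_of_gt hp.2))
    ha hab hτ (fun t htT r hr0 => by linear_combination -hs.mass t htT r hr0) hUa hUb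
    (fun r hr => neg_nonpos.2 (h0 r hr)) t htτ r hrab
  linarith

/-- The absolute angular momentum `r V + r² / 2` is transported by the flow. -/
theorem abs_angularMomentum_le (hs : IsRotatingShallowWater T h ht hr U Ut Ur V Vt Vr)
    {a b τ Λ : ℝ} (ha : 0 < a) (hab : a < b) (hτ : τ < T)
    (hUa : ∀ t ∈ Icc 0 τ, U t a = 0) (hUb : ∀ t ∈ Icc 0 τ, U t b = 0)
    (h0 : ∀ r ∈ Icc a b, |r * V 0 r + r * r / 2| ≤ Λ) :
    ∀ t ∈ Icc 0 τ, ∀ r ∈ Icc a b, |r * V t r + r * r / 2| ≤ Λ := by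
  intro t htτ r hrab
  have hL : HasC1Derivs T (fun t r => r * V t r + r * r * (1 / 2)) _ _ :=
    (HasC1Derivs.radius.mul hs.c1_V).add
      ((HasC1Derivs.radius.mul HasC1Derivs.radius).mul (HasC1Derivs.const (1 / 2)))
  have key : ∀ t ∈ Ioo 0 T, ∀ r, 0 < r →
      r * (Vt t r + U t r * Vr t r + U t r + V t r * U t r / r) =
      r * Vt t r + U t r * (V t r + r * Vr t r + r) := by
    intro t _ r hr0
    field_simp
    ring
  rw [abs_le]
  constructor
  · have := ((HasC1Derivs.const (-Λ)).sub hL).nonpos_of_transport hs.c1_U (c := fun _ _ => 0)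
      continuousOn_const ha hab hτ (fun t htT r hr0 => by
        linear_combination (key t htT r hr0) - r * hs.angular t htT r hr0) hUa hUb
      (fun r hr => by linarith [(abs_le.1 (h0 r hr)).1]) t htτ r hrab
    linarith
  · have := (hL.sub (HasC1Derivs.const Λ)).nonpos_of_transport hs.c1_U (c := fun _ _ => 0)
      continuousOn_const ha hab hτ (fun t htT r hr0 => by
        linear_combination r * hs.angular t htT r hr0 - (key t htT r hr0)) hUa hUb
      (fun r hr => by linarith [(abs_le.1 (h0 r hr)).2]) t htτ r hrab
    linarith

end IsRotatingShallowWater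

/-! ### Finite speed of propagation -/

/-- Near the rest state energy travels at speed at most `hbar + 2`: convection of kinetic energy
costs `|U| ≤ 1`, and the pressure work `h U (h - hbar)` costs `hbar + 1` by completing the square,
since `h ≤ 2 * hbar ≤ (hbar + 1) ^ 2`. -/
theorem abs_energyFlux_le {hbar h U V : ℝ} (hbar0 : 0 < hbar) (h0 : 0 ≤ h) (h2 : h ≤ 2 * hbar)
    (hU : |U| ≤ 1) :
    |U * (h * (U * U + V * V) * (1 / 2) + h * (h - hbar))| ≤
      (hbar + 2) * (h * (U * U + V * V) * (1 / 2) + (h - hbar) * (h - hbar) * (1 / 2)) := by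
  have hk : h ≤ (hbar + 1) ^ 2 := by nlinarith
  have hkin : 0 ≤ h * (U * U + V * V) * (1 / 2) :=
    mul_nonneg (mul_nonneg h0 (add_nonneg (mul_self_nonneg U) (mul_self_nonneg V))) (by norm_num)
  have key : ∀ σ : ℝ, |σ| = 1 → 0 ≤ (hbar + 1) * (h * (U * U) + (h - hbar) * (h - hbar))
      - 2 * σ * (h * U * (h - hbar)) := by
    intro σ hσ
    have hσ2 : σ ^ 2 = 1 := by rw [← sq_abs, hσ, one_pow]
    have h1 : 0 ≤ h * ((hbar + 1) * U - σ * (h - hbar)) ^ 2 := by positivity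
    have h2 : 0 ≤ ((hbar + 1) ^ 2 - h) * (h - hbar) ^ 2 := by
      have := sub_nonneg.2 hk
      positivity
    have h3 : 0 ≤ (hbar + 1) * ((hbar + 1) * (h * (U * U) + (h - hbar) * (h - hbar))
      - 2 * σ * (h * U * (h - hbar))) := by
      have : h * ((hbar + 1) * U - σ * (h - hbar)) ^ 2 + ((hbar + 1) ^ 2 - h) * (h - hbar) ^ 2 =
        (hbar + 1) * ((hbar + 1) * (h * (U * U) + (h - hbar) * (h - hbar))
        - 2 * σ * (h * U * (h - hbar))) := by linear_combination h * (h - hbar) ^ 2 * hσ2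
      linarith
    exact nonneg_of_mul_nonneg_right h3 (by linarith)
  have hp := key 1 (by simp)
  have hm := key (-1) (by simp)
  have hV : 0 ≤ (hbar + 1) * (h * (V * V)) :=
    mul_nonneg (by linarith) (mul_nonneg h0 (mul_self_nonneg V))
  have hd : 0 ≤ (h - hbar) * (h - hbar) := mul_self_nonneg _
  rw [abs_le] at hU ⊢
  have e1 := mul_le_mul_of_nonneg_right hU.1 hkin
  have e2 := mul_le_mul_of_nonneg_right hU.2 hkin
  constructor <;> nlinarith

theorem eq_rest_of_energy_eq_zero {hbar h U V : ℝ} (h0 : 0 < h)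
    (he : h * (U * U + V * V) * (1 / 2) + (h - hbar) * (h - hbar) * (1 / 2) = 0) :
    h = hbar ∧ U = 0 ∧ V = 0 := by
  have hUV := add_nonneg (mul_self_nonneg U) (mul_self_nonneg V)
  have hd := mul_self_nonneg (h - hbar)
  have hkin := mul_nonneg h0.le hUV
  have h1 : U * U + V * V = 0 :=
    (mul_eq_zero.1 (show h * (U * U + V * V) = 0 by linarith)).resolve_left h0.ne'
  exact ⟨sub_eq_zero.1 (mul_self_eq_zero.1 (by linarith)),
    mul_self_eq_zero.1 (by linarith [mul_self_nonneg U, mul_self_nonneg V]),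
    mul_self_eq_zero.1 (by linarith [mul_self_nonneg U, mul_self_nonneg V])⟩

namespace IsRotatingShallowWater

variable {T : ℝ} {h ht hr U Ut Ur V Vt Vr : ℝ → ℝ → ℝ}

/-- One time step of the domain of dependence property: the energy relative to the rest state
cannot enter a region whose boundaries move inwards with speed `hbar + 2`. -/
theorem rest_of_rest_at_time (hs : IsRotatingShallowWater T h ht hr U Ut Ur V Vt Vr)
    {hbar R₁ R₂ t₀ t₁ : ℝ} (hbar0 : 0 < hbar) (hR₁ : 0 < R₁) (hR : R₁ < R₂)
    (ht₀ : 0 ≤ t₀) (h01 : t₀ ≤ t₁) (ht₁ : t₁ < T)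
    (hrest : ∀ r, R₁ + (hbar + 2) * t₀ < r → r < R₂ - (hbar + 2) * t₀ →
      h t₀ r = hbar ∧ U t₀ r = 0 ∧ V t₀ r = 0)
    (hclose : ∀ t ∈ Icc t₀ t₁, ∀ r, R₁ + (hbar + 2) * t₀ < r → r < R₂ - (hbar + 2) * t₀ →
      |h t r - hbar| ≤ hbar / 2 ∧ |U t r| ≤ 1) :
    ∀ r, R₁ + (hbar + 2) * t₁ < r → r < R₂ - (hbar + 2) * t₁ →
      h t₁ r = hbar ∧ U t₁ r = 0 ∧ V t₁ r = 0 := by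
  set s := hbar + 2 with hs_def
  have hspos : 0 < s := by positivity
  have hUV := (hs.c1_U.mul hs.c1_U).add (hs.c1_V.mul hs.c1_V)
  have hd := hs.c1_h.sub (HasC1Derivs.const (T := T) hbar)
  have hkin := (hs.c1_h.mul hUV).mul (HasC1Derivs.const (1 / 2))
  have hen := HasC1Derivs.radius.mul (hkin.add ((hd.mul hd).mul (HasC1Derivs.const (1 / 2))))
  have hfl := HasC1Derivs.radius.mul (hs.c1_U.mul (hkin.add (hs.c1_h.mul hd)))
  have hst := (HasC1Derivs.const (T := T) s).mul HasC1Derivs.time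
  -- The weight `(r - R₁ - s t)₊² (R₂ - s t - r)₊²` is `C¹` and supported in the shrinking region.
  -- Its derivatives turn the energy balance into terms with factors `f - s e` and `-(f + s e)`,
  -- both nonpositive because `|f| ≤ s e`.
  have hφ := ((HasC1Derivs.radius.sub ((HasC1Derivs.const R₁).add hst)).max_zero_sq).mul
    (((HasC1Derivs.const R₂).sub hst).sub HasC1Derivs.radius).max_zero_sq
  have hq := hφ.mul hen
  have hf := hφ.mul hfl
  set e : ℝ → ℝ → ℝ := fun t r => h t r * (U t r * U t r + V t r * V t r) * (1 / 2)
    + (h t r - hbar) * (h t r - hbar) * (1 / 2) with he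
  set f : ℝ → ℝ → ℝ := fun t r => U t r * (h t r * (U t r * U t r + V t r * V t r) * (1 / 2)
    + h t r * (h t r - hbar)) with hf_def
  set x₁ : ℝ → ℝ → ℝ := fun t r => r - (R₁ + s * t) with hx₁
  set x₂ : ℝ → ℝ → ℝ := fun t r => R₂ - s * t - r with hx₂
  have hpos : ∀ t ∈ Icc t₀ t₁, ∀ r ∈ Icc R₁ R₂,
      0 ≤ max (x₁ t r) 0 ^ 2 * max (x₂ t r) 0 ^ 2 * (r * e t r) := by
    intro t htt r hrr
    rcases le_or_gt (x₁ t r) 0 with h1 | h1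
    · simp [max_eq_right h1]
    rcases le_or_gt (x₂ t r) 0 with h2 | h2
    · simp [max_eq_right h2]
    have hst := mul_le_mul_of_nonneg_left htt.1 hspos.le
    obtain ⟨b1, -⟩ := hclose t htt r (by simp only [hx₁] at h1; linarith)
      (by simp only [hx₂] at h2; linarith)
    have : 0 ≤ h t r := by linarith [(abs_le.1 b1).1]
    have hr0 : 0 < r := hR₁.trans_le hrr.1
    have : 0 ≤ e t r := add_nonneg
      (mul_nonneg (mul_nonneg this (add_nonneg (mul_self_nonneg _) (mul_self_nonneg _)))
        (by norm_num)) (mul_nonneg (mul_self_nonneg _) (by norm_num))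
    positivity
  have hE : ∫ r in R₁..R₂, max (x₁ t₁ r) 0 ^ 2 * max (x₂ t₁ r) 0 ^ 2 * (r * e t₁ r) ≤ 0 := by
    have hcont := (hq.integral_slice hR₁ hR.le ht₁).mono (Icc_subset_Icc_left ht₀)
    have h0 : ∫ r in R₁..R₂, max (x₁ t₀ r) 0 ^ 2 * max (x₂ t₀ r) 0 ^ 2 * (r * e t₀ r) = 0 := by
      refine (intervalIntegral.integral_congr (g := fun _ => (0 : ℝ)) fun r _ => ?_).trans
        (by simp)
      rcases le_or_gt (x₁ t₀ r) 0 with h1 | h1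
      · simp [max_eq_right h1]
      rcases le_or_gt (x₂ t₀ r) 0 with h2 | h2
      · simp [max_eq_right h2]
      obtain ⟨b1, b2, b3⟩ := hrest r (by simp only [hx₁] at h1; linarith)
        (by simp only [hx₂] at h2; linarith)
      simp [he, b1, b2, b3]
    have hder : ∀ t ∈ Ioo t₀ t₁, HasDerivAt
        (fun t => ∫ r in R₁..R₂, max (x₁ t r) 0 ^ 2 * max (x₂ t r) 0 ^ 2 * (r * e t r))
        ((∫ r in R₁..R₂, 2 * r * (max (x₁ t r) 0 * max (x₂ t r) 0 ^ 2 * (f t r - s * e t r)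
          - max (x₁ t r) 0 ^ 2 * max (x₂ t r) 0 * (f t r + s * e t r)))
        - (max (x₁ t R₂) 0 ^ 2 * max (x₂ t R₂) 0 ^ 2 * (R₂ * f t R₂)
          - max (x₁ t R₁) 0 ^ 2 * max (x₂ t R₁) 0 ^ 2 * (R₁ * f t R₁))) t := by
      intro t htt
      have htT : t ∈ Ioo 0 T := ⟨ht₀.trans_lt htt.1, htt.2.trans ht₁⟩
      refine hq.hasDerivAt_integral_of_balance hf hR₁ hR.le htT fun r hrr => ?_
      have hr0 : 0 < r := hR₁.trans_le hrr.1
      have e1 := hs.mass t htT r hr0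
      have e2 := hs.radial t htT r hr0
      have e3 := hs.angular t htT r hr0
      have hk : r * r⁻¹ = 1 := mul_inv_cancel₀ hr0.ne'
      simp only [div_eq_mul_inv] at e1 e2 e3
      simp only [he, hf_def]
      -- Energy identity: the Coriolis and centrifugal terms of the two momentum equations cancel.
      linear_combination max (x₁ t r) 0 ^ 2 * max (x₂ t r) 0 ^ 2 * r *
        (((U t r * U t r + V t r * V t r) * (1 / 2) + (h t r - hbar)) * e1
          + h t r * U t r * e2 + h t r * V t r * e3)
        - max (x₁ t r) 0 ^ 2 * max (x₂ t r) 0 ^ 2 * (h t r * U t r *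
          ((U t r * U t r + V t r * V t r) * (1 / 2) + (h t r - hbar))) * hk
    have hanti := mul_le_sub_of_le_deriv (c := 0)
      (y := fun t => -∫ r in R₁..R₂, max (x₁ t r) 0 ^ 2 * max (x₂ t r) 0 ^ 2 * (r * e t r))
      h01 hcont.neg (fun t htt => (hder t htt).neg) ?_
    · rw [h0, zero_mul, neg_zero, sub_zero] at hanti
      exact neg_nonneg.1 hanti
    intro t htt
    have hb1 : x₁ t R₁ ≤ 0 := by
      have : 0 ≤ s * t := mul_nonneg hspos.le (ht₀.trans htt.1.le)
      simp only [hx₁]; linarith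
    have hb2 : x₂ t R₂ ≤ 0 := by
      have : 0 ≤ s * t := mul_nonneg hspos.le (ht₀.trans htt.1.le)
      simp only [hx₂]; linarith
    simp only [max_eq_right hb1, max_eq_right hb2]
    have hnp : 0 ≤ ∫ r in R₁..R₂, -(2 * r * (max (x₁ t r) 0 * max (x₂ t r) 0 ^ 2 *
        (f t r - s * e t r) - max (x₁ t r) 0 ^ 2 * max (x₂ t r) 0 * (f t r + s * e t r))) := by
      refine intervalIntegral.integral_nonneg hR.le fun r hrr => ?_
      rcases le_or_gt (x₁ t r) 0 with h1 | h1
      · simp [max_eq_right h1]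
      rcases le_or_gt (x₂ t r) 0 with h2 | h2
      · simp [max_eq_right h2]
      have hst := mul_le_mul_of_nonneg_left htt.1.le hspos.le
      obtain ⟨b1, b2⟩ := hclose t (Ioo_subset_Icc_self htt) r
        (by simp only [hx₁] at h1; linarith) (by simp only [hx₂] at h2; linarith)
      rw [abs_le] at b1
      have hflux := abs_le.1 (abs_energyFlux_le (h := h t r) (V := V t r) hbar0 (by linarith) (by linarith) b2)
      have hr0 : 0 < r := hR₁.trans_le hrr.1
      have c1 : 0 ≤ s * e t r - f t r := sub_nonneg.2 hflux.2
      have c2 : 0 ≤ s * e t r + f t r := neg_le_iff_add_nonneg'.1 hflux.1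
      rw [max_eq_left h1.le, max_eq_left h2.le]
      have d1 : 0 ≤ 2 * r * (x₁ t r * x₂ t r ^ 2 * (s * e t r - f t r)) := by positivity
      have d2 : 0 ≤ 2 * r * (x₁ t r ^ 2 * x₂ t r * (s * e t r + f t r)) := by positivity
      linarith
    rw [intervalIntegral.integral_neg] at hnp
    simpa using hnp
  intro r hr1 hr2
  have hst : 0 ≤ s * t₁ := mul_nonneg hspos.le (ht₀.trans h01)
  have hrr : r ∈ Icc R₁ R₂ := ⟨by linarith, by linarith⟩
  have hz := eqOn_zero_of_integral_nonpos hR (hq.slice hR₁ ⟨ht₀.trans h01, ht₁⟩)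
    (hpos t₁ (right_mem_Icc.2 h01)) hE r hrr
  have h1 : 0 < x₁ t₁ r := by simp only [hx₁]; linarith
  have h2 : 0 < x₂ t₁ r := by simp only [hx₂]; linarith
  have hr0 : 0 < r := hR₁.trans_le hrr.1
  rw [max_eq_left h1.le, max_eq_left h2.le] at hz
  have he0 : e t₁ r = 0 := by
    have : x₁ t₁ r ^ 2 * x₂ t₁ r ^ 2 * r ≠ 0 := by positivity
    exact (mul_eq_zero.1 (by rw [mul_assoc]; exact hz)).resolve_left this
  have hst' := mul_le_mul_of_nonneg_left h01 hspos.le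
  have hh : 0 < h t₁ r := by
    linarith [(abs_le.1 (hclose t₁ (right_mem_Icc.2 h01) r (by linarith) (by linarith)).1).1]
  exact eq_rest_of_energy_eq_zero hh he0

/-- Finite speed of propagation: the rest state persists in the domain of dependence of the
interval on which the data are at rest. -/
theorem rest_of_rest_initially (hs : IsRotatingShallowWater T h ht hr U Ut Ur V Vt Vr)
    {hbar R₁ R₂ : ℝ} (hbar0 : 0 < hbar) (hR₁ : 0 < R₁) (hR : R₁ < R₂)
    (hrest : ∀ r, R₁ < r → r < R₂ → h 0 r = hbar ∧ U 0 r = 0 ∧ V 0 r = 0) :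
    ∀ t ∈ Ico 0 T, ∀ r, R₁ + (hbar + 2) * t < r → r < R₂ - (hbar + 2) * t →
      h t r = hbar ∧ U t r = 0 ∧ V t r = 0 := by
  intro τ hτ
  have hcpt : IsCompact (Icc 0 τ ×ˢ Icc R₁ R₂) := isCompact_Icc.prod isCompact_Icc
  have hsub : Icc 0 τ ×ˢ Icc R₁ R₂ ⊆ Ico 0 T ×ˢ Ioi 0 :=
    prod_mono (Icc_subset_Ico_right hτ.2) fun _ hr => hR₁.trans_le hr.1
  have uh := hcpt.uniformContinuousOn_of_continuous (hs.c1_h.cont.mono hsub)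
  have uU := hcpt.uniformContinuousOn_of_continuous (hs.c1_U.cont.mono hsub)
  rw [Metric.uniformContinuousOn_iff] at uh uU
  obtain ⟨δ₁, hδ₁, uh⟩ := uh (hbar / 2) (by positivity)
  obtain ⟨δ₂, hδ₂, uU⟩ := uU 1 one_pos
  obtain ⟨δ, hδ, hδlt⟩ := exists_between (lt_min hδ₁ hδ₂)
  -- By uniform continuity, over a time step of length `δ` the solution moves less than the
  -- closeness required by `rest_of_rest_at_time`; induction on the number of steps reaches `τ`.
  have main : ∀ n : ℕ, ∀ t ∈ Icc 0 τ, t ≤ n * δ → ∀ r, R₁ + (hbar + 2) * t < r →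
      r < R₂ - (hbar + 2) * t → h t r = hbar ∧ U t r = 0 ∧ V t r = 0 := by
    intro n
    induction n with
    | zero =>
      intro t htt hle r hr1 hr2
      obtain rfl : t = 0 := le_antisymm (by simpa using hle) htt.1
      exact hrest r (by simpa using hr1) (by simpa using hr2)
    | succ n ih =>
      intro t htt hle
      have hmem : max 0 (t - δ) ∈ Icc 0 τ :=
        ⟨le_max_left _ _, max_le (htt.1.trans htt.2) (by linarith [htt.2])⟩
      have hold := ih (max 0 (t - δ)) hmem
        (max_le (by positivity) (by push_cast at hle; linarith))
      refine hs.rest_of_rest_at_time hbar0 hR₁ hR hmem.1 (max_le htt.1 (by linarith))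
        (htt.2.trans_lt hτ.2) hold fun t' ht' r hr1 hr2 => ?_
      have hs0 : 0 ≤ (hbar + 2) * max 0 (t - δ) := mul_nonneg (by positivity) hmem.1
      have hrr : r ∈ Icc R₁ R₂ := ⟨by linarith, by linarith⟩
      have hdist : dist (t', r) (max 0 (t - δ), r) < min δ₁ δ₂ := by
        rw [Prod.dist_eq, dist_self, max_eq_left dist_nonneg, Real.dist_eq,
          abs_of_nonneg (sub_nonneg.2 ht'.1)]
        linarith [ht'.2, le_max_right 0 (t - δ)]
      have hmem' : t' ∈ Icc 0 τ := ⟨hmem.1.trans ht'.1, ht'.2.trans htt.2⟩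
      obtain ⟨o1, o2, -⟩ := hold r hr1 hr2
      have c1 := uh (t', r) ⟨hmem', hrr⟩ (max 0 (t - δ), r) ⟨hmem, hrr⟩
        (hdist.trans_le (min_le_left _ _))
      have c2 := uU (t', r) ⟨hmem', hrr⟩ (max 0 (t - δ), r) ⟨hmem, hrr⟩
        (hdist.trans_le (min_le_right _ _))
      simp only [Real.dist_eq, o1, o2, sub_zero] at c1 c2
      exact ⟨c1.le, c2.le⟩
  obtain ⟨n, hn⟩ := exists_nat_ge (τ / δ)
  exact main n τ ⟨hτ.1, le_rfl⟩ ((div_le_iff₀ hδ).1 hn)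

end IsRotatingShallowWater

/-! ### Riccati inequalities -/

/-- A solution of `y' ≥ α y² + γ` lives for a time less than `π / √(α γ)`. -/
theorem sqrt_mul_lt_pi_of_riccati {y y' : ℝ → ℝ} {τ α γ : ℝ} (hα : 0 < α) (hγ : 0 < γ)
    (hτ : 0 ≤ τ) (hy : ContinuousOn y (Icc 0 τ))
    (hy' : ∀ t ∈ Ioo 0 τ, HasDerivAt y (y' t) t)
    (hr : ∀ t ∈ Ioo 0 τ, α * y t ^ 2 + γ ≤ y' t) : √(α * γ) * τ < Real.pi := by
  set k := √(α / γ) with hk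
  have hk0 : 0 < k := Real.sqrt_pos.2 (div_pos hα hγ)
  have hk2 : k ^ 2 = α / γ := Real.sq_sqrt (div_pos hα hγ).le
  have hkγ : √(α * γ) = k * γ := by
    rw [Real.sqrt_eq_iff_mul_self_eq (by positivity) (by positivity)]
    have : k * γ * (k * γ) = k ^ 2 * γ ^ 2 := by ring
    rw [this, hk2]
    field_simp
  -- `arctan (k y)` grows at rate at least `√(α γ)`, but its range has length `π`.
  have h := mul_le_sub_of_le_deriv (y := fun t => Real.arctan (k * y t)) (c := √(α * γ))
    (y' := fun t => 1 / (1 + (k * y t) ^ 2) * (k * y' t)) hτ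
    (Real.continuous_arctan.comp_continuousOn (hy.const_smul k))
    (fun t ht => ((hy' t ht).const_mul k).arctan)
    (fun t ht => by
      rw [hkγ, one_div_mul_eq_div, le_div_iff₀ (by positivity)]
      have : k * γ * (1 + (k * y t) ^ 2) = k * (α * y t ^ 2 + γ) := by
        rw [mul_pow, hk2]
        field_simp
        ring
      rw [this]
      exact mul_le_mul_of_nonneg_left (hr t ht) hk0.le)
  have h1 := Real.arctan_lt_pi_div_two (k * y τ)
  have h2 := Real.neg_pi_div_two_lt_arctan (k * y 0)
  simp only [sub_zero] at h
  linarith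

/-- The lifespan of solutions of `y' ≥ α y² - γ` with large initial value. -/
theorem mul_lt_two_of_riccati {y y' : ℝ → ℝ} {τ α γ Y : ℝ} (hγ : 0 ≤ γ) (hY : 0 < Y)
    (hα : 0 ≤ α) (hτ : 0 ≤ τ) (hy : ContinuousOn y (Icc 0 τ))
    (hy' : ∀ t ∈ Ioo 0 τ, HasDerivAt y (y' t) t)
    (hr : ∀ t ∈ Ioo 0 τ, α * y t ^ 2 - γ ≤ y' t) (h0 : 2 * Y ≤ y 0) (hγτ : γ * τ ≤ Y)
    (hγY : 2 * γ ≤ α * Y ^ 2) : α * Y * τ < 2 := by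
  have hlow : ∀ t ∈ Icc 0 τ, Y ≤ y t := by
    intro t ht
    have h := mul_le_sub_of_le_deriv (c := -γ) ht.1 (hy.mono (Icc_subset_Icc_right ht.2))
      (fun s hs => hy' s ⟨hs.1, hs.2.trans_le ht.2⟩)
      (fun s hs => by
        have := hr s ⟨hs.1, hs.2.trans_le ht.2⟩
        have : 0 ≤ α * y s ^ 2 := by positivity
        linarith)
    have : γ * t ≤ γ * τ := mul_le_mul_of_nonneg_left ht.2 hγ
    linarith
  have hpos : ∀ t ∈ Icc 0 τ, 0 < y t := fun t ht => hY.trans_le (hlow t ht)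
  -- Since `y ≥ Y`, half of `α y²` absorbs `γ`, so `y' ≥ α y² / 2` and `-1 / y` grows at rate at
  -- least `α / 2`.
  have h := mul_le_sub_of_le_deriv (y := fun t => -(y t)⁻¹) (c := α / 2)
    (y' := fun t => -(-y' t / y t ^ 2)) hτ (hy.inv₀ fun t ht => (hpos t ht).ne').neg
    (fun t ht => ((hy' t ht).inv (hpos t (Ioo_subset_Icc_self ht)).ne').neg)
    (fun t ht => by
      have hp := hpos t (Ioo_subset_Icc_self ht)
      rw [neg_div, neg_neg, le_div_iff₀ (by positivity)]
      have h1 := hr t ht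
      have h2 : Y ^ 2 ≤ y t ^ 2 := pow_le_pow_left₀ hY.le (hlow t (Ioo_subset_Icc_self ht)) 2
      have h3 := mul_le_mul_of_nonneg_left h2 hα
      linarith)
  have h1 : 0 < (y τ)⁻¹ := inv_pos.2 (hpos τ (right_mem_Icc.2 hτ))
  have h2 : (y 0)⁻¹ ≤ Y⁻¹ := inv_anti₀ hY (hlow 0 (left_mem_Icc.2 hτ))
  have h3 : α / 2 * τ < Y⁻¹ := by
    simp only [sub_zero] at h
    linarith
  have h4 := mul_lt_mul_of_pos_right h3 hY
  rw [inv_mul_cancel₀ hY.ne'] at h4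
  linarith

/-! ### Mass and the two momentum functionals -/

namespace IsRotatingShallowWater

variable {T : ℝ} {h ht hr U Ut Ur V Vt Vr : ℝ → ℝ → ℝ} {a b τ hbar : ℝ}

theorem integral_mass_eq (hs : IsRotatingShallowWater T h ht hr U Ut Ur V Vt Vr)
    (ha : 0 < a) (hab : a ≤ b) (hτ : τ < T)
    (hUa : ∀ t ∈ Icc 0 τ, U t a = 0) (hUb : ∀ t ∈ Icc 0 τ, U t b = 0) :
    ∀ t ∈ Icc 0 τ, ∫ r in a..b, r * h t r = ∫ r in a..b, r * h 0 r := by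
  intro t htτ
  have hq := HasC1Derivs.radius.mul hs.c1_h
  have hcont := hq.integral_slice ha hab (htτ.2.trans_lt hτ)
  have hder : ∀ s ∈ Ioo 0 t, HasDerivAt (fun s => ∫ r in a..b, r * h s r) 0 s := by
    intro s hst
    have hsT : s ∈ Ioo 0 T := ⟨hst.1, hst.2.trans_le htτ.2 |>.trans hτ⟩
    have hsτ : s ∈ Icc 0 τ := ⟨hst.1.le, hst.2.le.trans htτ.2⟩
    have := hq.hasDerivAt_integral_of_balance (g := fun _ => 0)
      (HasC1Derivs.radius.mul (hs.c1_h.mul hs.c1_U)) ha hab hsT (fun r hrab => by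
        have hr0 : 0 < r := ha.trans_le hrab.1
        have e1 := hs.mass s hsT r hr0
        have hk : r * r⁻¹ = 1 := mul_inv_cancel₀ hr0.ne'
        rw [div_eq_mul_inv] at e1
        linear_combination r * e1 - h s r * U s r * hk)
    simpa [hUa s hsτ, hUb s hsτ] using this
  have h1 := mul_le_sub_of_le_deriv htτ.1 hcont hder fun _ _ => le_rfl
  have h2 := mul_le_sub_of_le_deriv (y := fun s => -∫ r in a..b, r * h s r) htτ.1 hcont.neg
    (fun s hs => (hder s hs).neg) fun _ _ => le_rfl
  simp only [neg_zero, zero_mul] at h1 h2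
  linarith

/-- Growth of the second order radial momentum, driven by the pressure. -/
theorem exists_deriv_integral_sq_mul_momentum
    (hs : IsRotatingShallowWater T h ht hr U Ut Ur V Vt Vr)
    (ha : 0 < a) (hab : a ≤ b) {t m : ℝ} (htT : t ∈ Ioo 0 T) (hm0 : 0 < m)
    (hUa : U t a = 0) (hUb : U t b = 0) (hha : h t a = hbar) (hhb : h t b = hbar)
    (hpos : ∀ r ∈ Icc a b, 0 ≤ h t r) (hm : ∫ r in a..b, r * h t r = m) :
    ∃ d, HasDerivAt (fun s => ∫ r in a..b, r * r * (h s r * U s r)) d t ∧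
      (∫ r in a..b, r * r * (h t r * U t r)) ^ 2 / (b ^ 2 * m) + m ^ 2 / b ^ 2
        - b ^ 2 * m / 4 - b ^ 2 * hbar ^ 2 / 2 ≤ d := by
  have htT' := Ioo_subset_Ico_self htT
  have hb : 0 < b := ha.trans_le hab
  have hq := (HasC1Derivs.radius.mul HasC1Derivs.radius).mul (hs.c1_h.mul hs.c1_U)
  have hf := (HasC1Derivs.radius.mul HasC1Derivs.radius).mul
    ((hs.c1_h.mul (hs.c1_U.mul hs.c1_U)).add ((hs.c1_h.mul hs.c1_h).mul (HasC1Derivs.const (1/2))))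
  have hg := ((HasC1Derivs.radius.mul ((hs.c1_h.mul (hs.c1_U.mul hs.c1_U)).add
    (hs.c1_h.mul hs.c1_h))).add ((HasC1Derivs.radius.mul hs.c1_h).mul
      ((HasC1Derivs.radius.mul hs.c1_V).add (hs.c1_V.mul hs.c1_V))))
  have hD := hq.hasDerivAt_integral_of_balance hf ha hab htT
    (g := fun r => r * (h t r * (U t r * U t r) + h t r * h t r)
      + r * h t r * (r * V t r + V t r * V t r)) (fun r hrab => by
        have hr0 : 0 < r := ha.trans_le hrab.1
        have e1 := hs.mass t htT r hr0
        have e2 := hs.radial t htT r hr0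
        have hk : r * r⁻¹ = 1 := mul_inv_cancel₀ hr0.ne'
        rw [div_eq_mul_inv] at e1 e2
        linear_combination r * r * U t r * e1 + r * r * h t r * e2
          - r * (h t r * U t r * U t r - h t r * V t r ^ 2) * hk)
  set J := ∫ r in a..b, r * r * (h t r * U t r) with hJ
  refine ⟨_, hD, ?_⟩
  -- Cauchy–Schwarz in tangent-line form: `U² ≥ 2 μ r U - μ² r²` and `h² ≥ 2 l h - l²`, with slopes
  -- chosen so that integration gives `J² / (b² m)` and `m² / b²`. For the rotation, `r V + V² ≥ -r²
  -- / 4` needs no bound on `V`.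
  set μ := J / (b ^ 2 * m) with hμ
  set l := m / b ^ 2 with hl
  have hint : ∫ r in a..b, (2 * μ * (r * r * (h t r * U t r))
      + (2 * l - μ ^ 2 * b ^ 2 - b ^ 2 / 4) * (r * h t r) - l ^ 2 * b)
      = 2 * μ * J + (2 * l - μ ^ 2 * b ^ 2 - b ^ 2 / 4) * m - l ^ 2 * b * (b - a) := by
    have i1 := ((hq.slice (b := b) ha htT').intervalIntegrable_of_Icc
      (μ := volume) hab).const_mul (2 * μ)
    have i2 := (((HasC1Derivs.radius.mul hs.c1_h).slice (b := b) ha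
      htT').intervalIntegrable_of_Icc (μ := volume) hab).const_mul (2 * l - μ ^ 2 * b ^ 2 - b ^ 2 / 4)
    have i3 : IntervalIntegrable (fun r => 2 * μ * (r * r * (h t r * U t r))
      + (2 * l - μ ^ 2 * b ^ 2 - b ^ 2 / 4) * (r * h t r)) volume a b := i1.add i2
    rw [intervalIntegral.integral_sub i3 intervalIntegrable_const,
      intervalIntegral.integral_add i1 i2, intervalIntegral.integral_const_mul,
      intervalIntegral.integral_const_mul, hm, ← hJ, intervalIntegral.integral_const, smul_eq_mul]
    ring
  have hle : ∫ r in a..b, (2 * μ * (r * r * (h t r * U t r))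
      + (2 * l - μ ^ 2 * b ^ 2 - b ^ 2 / 4) * (r * h t r) - l ^ 2 * b)
      ≤ ∫ r in a..b, (r * (h t r * (U t r * U t r) + h t r * h t r)
      + r * h t r * (r * V t r + V t r * V t r)) := by
    refine intervalIntegral.integral_mono_on hab ?_
      ((hg.slice ha htT').intervalIntegrable_of_Icc hab) fun r hrab => ?_
    · exact ((((hq.slice ha htT').const_smul (2 * μ)).add
        (((HasC1Derivs.radius.mul hs.c1_h).slice ha htT').const_smul
        (2 * l - μ ^ 2 * b ^ 2 - b ^ 2 / 4))).sub continuousOn_const).intervalIntegrable_of_Icc hab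
    · have hr0 : 0 < r := ha.trans_le hrab.1
      have hrh : 0 ≤ r * h t r := mul_nonneg hr0.le (hpos r hrab)
      have hr2 : 0 ≤ b ^ 2 - r ^ 2 := sub_nonneg.2 (pow_le_pow_left₀ hr0.le hrab.2 2)
      have p1 : 0 ≤ r * h t r * (U t r - μ * r) ^ 2 := mul_nonneg hrh (sq_nonneg _)
      have p2 : 0 ≤ r * h t r * (b ^ 2 - r ^ 2) * μ ^ 2 :=
        mul_nonneg (mul_nonneg hrh hr2) (sq_nonneg _)
      have p3 : 0 ≤ r * (h t r - l) ^ 2 := mul_nonneg hr0.le (sq_nonneg _)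
      have p4 : 0 ≤ l ^ 2 * (b - r) := mul_nonneg (sq_nonneg _) (sub_nonneg.2 hrab.2)
      have p5 : 0 ≤ r * h t r * (V t r + r / 2) ^ 2 := mul_nonneg hrh (sq_nonneg _)
      have p6 : 0 ≤ r * h t r * (b ^ 2 - r ^ 2) := mul_nonneg hrh hr2
      linear_combination p1 + p2 + p3 + p4 + p5 + p6 / 4
  rw [hint] at hle
  have hval : 2 * μ * J + (2 * l - μ ^ 2 * b ^ 2 - b ^ 2 / 4) * m - l ^ 2 * b * b
      = J ^ 2 / (b ^ 2 * m) + m ^ 2 / b ^ 2 - b ^ 2 * m / 4 := by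
    rw [hμ, hl]
    field_simp
    ring
  have p7 : 0 ≤ l ^ 2 * b * a := by positivity
  have p8 : 0 ≤ a ^ 2 * hbar ^ 2 := by positivity
  simp only [hUa, hUb, hha, hhb]
  linear_combination hle - hval + p7 + p8 / 2

/-- Growth of the inward momentum. -/
theorem exists_deriv_neg_integral_momentum
    (hs : IsRotatingShallowWater T h ht hr U Ut Ur V Vt Vr)
    (ha : 0 < a) (hab : a ≤ b) {t m Λ : ℝ} (htT : t ∈ Ioo 0 T) (hm0 : 0 < m)
    (hUa : U t a = 0) (hUb : U t b = 0) (hha : h t a = hbar) (hhb : h t b = hbar)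
    (hpos : ∀ r ∈ Icc a b, 0 ≤ h t r) (hm : ∫ r in a..b, r * h t r = m)
    (hΛ : ∀ r ∈ Icc a b, |r * V t r + r * r / 2| ≤ Λ) :
    ∃ d, HasDerivAt (fun s => ∫ r in a..b, -(h s r * U s r)) d t ∧
      (∫ r in a..b, -(h t r * U t r)) ^ 2 / m - Λ ^ 2 / a ^ 4 * m ≤ d := by
  have htT' := Ioo_subset_Ico_self htT
  have hq := (hs.c1_h.mul hs.c1_U).neg
  have hf := ((hs.c1_h.mul (hs.c1_U.mul hs.c1_U)).add
    ((hs.c1_h.mul hs.c1_h).mul (HasC1Derivs.const (1 / 2)))).neg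
  have hg : ContinuousOn (fun r => h t r * (U t r * U t r) / r - h t r * V t r
      - h t r * (V t r * V t r) / r) (Icc a b) := by
    have c1 := hs.c1_h.slice (b := b) ha htT'
    have c2 := hs.c1_U.slice (b := b) ha htT'
    have c3 := hs.c1_V.slice (b := b) ha htT'
    have hne : ∀ r ∈ Icc a b, r ≠ 0 := fun r hr => (ha.trans_le hr.1).ne'
    exact (((c1.mul (c2.mul c2)).div continuousOn_id hne).sub (c1.mul c3)).sub
      ((c1.mul (c3.mul c3)).div continuousOn_id hne)
  have hD := hq.hasDerivAt_integral_of_balance hf ha hab htT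
    (g := fun r => h t r * (U t r * U t r) / r - h t r * V t r
      - h t r * (V t r * V t r) / r) (fun r hrab => by
        have hr0 : 0 < r := ha.trans_le hrab.1
        linear_combination -U t r * hs.mass t htT r hr0 - h t r * hs.radial t htT r hr0)
  set F := ∫ r in a..b, -(h t r * U t r) with hF
  refine ⟨_, hD, ?_⟩
  -- Again the tangent-line form of Cauchy–Schwarz, now `U² ≥ -2 μ r U - μ² r²`. Without a weight
  -- the pressure is an exact derivative, and its boundary values at `a` and `b` cancel.
  set μ := F / m with hμ
  set K := Λ ^ 2 / a ^ 4 with hK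
  have hint : ∫ r in a..b, (2 * μ * (-(h t r * U t r)) + (-μ ^ 2 - K) * (r * h t r))
      = 2 * μ * F + (-μ ^ 2 - K) * m := by
    have i1 := ((hq.slice (b := b) ha htT').intervalIntegrable_of_Icc
      (μ := volume) hab).const_mul (2 * μ)
    have i2 := (((HasC1Derivs.radius.mul hs.c1_h).slice (b := b) ha
      htT').intervalIntegrable_of_Icc (μ := volume) hab).const_mul (-μ ^ 2 - K)
    rw [intervalIntegral.integral_add i1 i2, intervalIntegral.integral_const_mul,
      intervalIntegral.integral_const_mul, hm, ← hF]
  have hle : ∫ r in a..b, (2 * μ * (-(h t r * U t r)) + (-μ ^ 2 - K) * (r * h t r))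
      ≤ ∫ r in a..b, (h t r * (U t r * U t r) / r - h t r * V t r
        - h t r * (V t r * V t r) / r) := by
    refine intervalIntegral.integral_mono_on hab ?_
      (hg.intervalIntegrable_of_Icc hab) fun r hrab => ?_
    · exact (((hq.slice ha htT').const_smul (2 * μ)).add
        (((HasC1Derivs.radius.mul hs.c1_h).slice ha htT').const_smul
        (-μ ^ 2 - K))).intervalIntegrable_of_Icc hab
    · have hr0 : 0 < r := ha.trans_le hrab.1
      have hh := hpos r hrab
      have p1 : 0 ≤ h t r * (U t r + μ * r) ^ 2 / r := by positivity
      have hL : (r * V t r + r * r / 2) ^ 2 ≤ Λ ^ 2 := by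
        rw [← sq_abs]
        exact pow_le_pow_left₀ (abs_nonneg _) (hΛ r hrab) 2
      have hra : a ^ 4 ≤ r ^ 4 := pow_le_pow_left₀ ha.le hrab.1 4
      have hKr : Λ ^ 2 ≤ K * r ^ 4 := by
        rw [hK, div_mul_eq_mul_div, le_div_iff₀ (by positivity)]
        exact mul_le_mul_of_nonneg_left hra (sq_nonneg _)
      -- With `L = r V + r² / 2`, one has `V + V² / r = L² / r³ - r / 4 ≤ K r`, by `|L| ≤ Λ` and `r
      -- ≥ a`.
      have p2 : 0 ≤ h t r * (K * r ^ 4 + r ^ 4 / 4 - (r * V t r + r * r / 2) ^ 2) / r ^ 3 := by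
        have : 0 ≤ K * r ^ 4 + r ^ 4 / 4 - (r * V t r + r * r / 2) ^ 2 := by
          have : 0 ≤ r ^ 4 / 4 := by positivity
          linarith
        positivity
      have e1 : h t r * (U t r + μ * r) ^ 2 / r = h t r * (U t r * U t r) / r
          + 2 * μ * (h t r * U t r) + μ ^ 2 * (r * h t r) := by
        field_simp
        ring
      have e2 : h t r * (K * r ^ 4 + r ^ 4 / 4 - (r * V t r + r * r / 2) ^ 2) / r ^ 3
          = K * (r * h t r) - h t r * V t r - h t r * (V t r * V t r) / r := by
        field_simp
        ring
      linear_combination p1 + p2 + e1 + e2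
  rw [hint] at hle
  have hval : 2 * μ * F + (-μ ^ 2 - K) * m = F ^ 2 / m - K * m := by
    rw [hμ]
    field_simp
    ring
  simp only [hUa, hUb, hha, hhb]
  linear_combination hle - hval

end IsRotatingShallowWater

/-! ### Norms on the half-line -/

/-- For continuous `f` the set where `|f|` exceeds its essential supremum is open and null, hence
empty. This makes the bound on `V₀` pointwise. -/
theorem abs_le_halfLineNorm_top {f : ℝ → ℝ} {β₁ β₂ : ℝ} (hβ₁ : 0 < β₁)
    (hf : ContinuousOn f (Ioi 0)) (h0 : ∀ r, 0 < r → r ∉ Icc β₁ β₂ → f r = 0) :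
    ∀ r, 0 < r → |f r| ≤ halfLineNorm ∞ f := by
  obtain ⟨K, hK⟩ := (isCompact_Icc (a := β₁) (b := β₂)).exists_bound_of_continuousOn
    (hf.mono fun r hr => hβ₁.trans_le hr.1)
  have hmem : MemLp f ∞ (volume.restrict (Ioi 0)) := by
    refine memLp_top_of_bound (hf.aestronglyMeasurable measurableSet_Ioi) (max K 0) ?_
    filter_upwards [ae_restrict_mem measurableSet_Ioi] with r hr
    by_cases hrβ : r ∈ Icc β₁ β₂
    · exact (hK r hrβ).trans (le_max_left _ _)
    · simp [h0 r hr hrβ]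
  have hae := ae_le_lpNorm_exponent_top hmem
  have hopen : IsOpen (Ioi (0 : ℝ) ∩ (fun r => ‖f r‖) ⁻¹' Ioi (halfLineNorm ∞ f)) :=
    hf.norm.isOpen_inter_preimage isOpen_Ioi isOpen_Ioi
  have hnull : volume (Ioi (0 : ℝ) ∩ (fun r => ‖f r‖) ⁻¹' Ioi (halfLineNorm ∞ f)) = 0 := by
    rw [ae_restrict_iff' measurableSet_Ioi] at hae
    refine measure_mono_null (fun r hr => ?_) hae
    simp only [mem_compl_iff, mem_ofPred_eq, not_forall]
    exact ⟨hr.1, not_le.2 hr.2⟩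
  have hempty := (hopen.measure_eq_zero_iff volume).1 hnull
  intro r hr
  by_contra hlt
  exact eq_empty_iff_forall_notMem.1 hempty r ⟨hr, lt_of_not_ge hlt⟩

theorem halfLineNorm_one_eq {f : ℝ → ℝ} {a b : ℝ} (ha : 0 ≤ a) (hab : a ≤ b)
    (hf : ContinuousOn f (Ioi 0)) (h0 : ∀ r, 0 < r → r ∉ Ioc a b → f r = 0) :
    halfLineNorm 1 f = ∫ r in a..b, |f r| := by
  rw [halfLineNorm, lpNorm_one_eq_integral_norm (hf.aestronglyMeasurable measurableSet_Ioi),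
    intervalIntegral.integral_of_le hab]
  refine setIntegral_eq_of_subset_of_forall_sdiff_eq_zero measurableSet_Ioi
    (fun r hr => ha.trans_lt hr.1) fun r hr => ?_
  rw [h0 r hr.1 hr.2, norm_zero]

/-! ### Lifespan estimate and conclusion -/

/-- A solution at rest near `r = a` and `r = b` whose data have a large inward momentum compared
with `x ^ 3` ceases to exist before the time `y / x`, if `x`, `y` and `x / y` are large. -/
theorem IsRotatingShallowWater.lifespan_le {T : ℝ} {h ht hr U Ut Ur V Vt Vr : ℝ → ℝ → ℝ}
    (hs : IsRotatingShallowWater T h ht hr U Ut Ur V Vt Vr) {a b hbar Λ c x y : ℝ}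
    (ha : 0 < a) (hab : a < b) (hhbar : 0 < hbar) (hc : 0 < c) (hx : 0 < x) (hy : 0 < y)
    (hUa : ∀ t ∈ Icc 0 (y / x), t < T → U t a = 0) (hUb : ∀ t ∈ Icc 0 (y / x), t < T → U t b = 0)
    (hha : ∀ t ∈ Icc 0 (y / x), t < T → h t a = hbar)
    (hhb : ∀ t ∈ Icc 0 (y / x), t < T → h t b = hbar)
    (hh0 : ∀ r ∈ Icc a b, 0 < h 0 r) (hΛ : ∀ r ∈ Icc a b, |r * V 0 r + r * r / 2| ≤ Λ)
    (hF : c * x ^ 3 ≤ ∫ r in a..b, -(h 0 r * U 0 r)) (hyx : y ≤ x)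
    (hx₁ : 2 * (Λ ^ 2 / a ^ 4) ≤ c * x) (hx₂ : 8 * (Λ ^ 2 / a ^ 4) ≤ c ^ 2 * x ^ 2)
    (hx₃ : b ^ 4 ≤ x ^ 2) (hx₄ : 2 * b ^ 2 * hbar ≤ x ^ 2) (hy₁ : 4 ≤ c * y)
    (hy₂ : 8 * b ^ 2 ≤ y) : T ≤ y / x := by
  by_contra! hτ
  set τ := y / x with hτ_def
  have hτ0 : 0 < τ := div_pos hy hx
  have hb : 0 < b := ha.trans hab
  have h0T : (0 : ℝ) ∈ Ico 0 T := ⟨le_rfl, hτ0.trans hτ⟩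
  replace hUa : ∀ t ∈ Icc 0 τ, U t a = 0 := fun t ht' => hUa t ht' (ht'.2.trans_lt hτ)
  replace hUb : ∀ t ∈ Icc 0 τ, U t b = 0 := fun t ht' => hUb t ht' (ht'.2.trans_lt hτ)
  have hpos := hs.height_nonneg ha hab hτ hUa hUb fun r hrab => (hh0 r hrab).le
  have hang := hs.abs_angularMomentum_le ha hab hτ hUa hUb hΛ
  have hmass := hs.integral_mass_eq ha hab.le hτ hUa hUb
  set m := ∫ r in a..b, r * h 0 r with hm_def
  have hm0 : 0 < m := by
    have hcm := (HasC1Derivs.radius.mul hs.c1_h).slice (b := b) ha h0T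
    exact intervalIntegral.intervalIntegral_pos_of_pos_on
      (hcm.intervalIntegrable_of_Icc hab.le)
      (fun r hrab => mul_pos (ha.trans hrab.1) (hh0 r (Ioo_subset_Icc_self hrab))) hab
  have hsub : ∀ t ∈ Ioo 0 τ, t ∈ Ioo 0 T ∧ t ∈ Icc 0 τ ∧ t < T := fun t ht' =>
    ⟨⟨ht'.1, ht'.2.trans hτ⟩, Ioo_subset_Icc_self ht', ht'.2.trans hτ⟩
  rcases le_total m (x ^ 2) with hm | hm
  -- Light case: the inward momentum starts above `2 Y = c x³`, and `α Y τ ≥ c y / 2 ≥ 2`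
  -- contradicts the Riccati bound.
  · have hd : ∀ t ∈ Ioo 0 τ, ∃ d, HasDerivAt (fun s => ∫ r in a..b, -(h s r * U s r)) d t ∧
        (∫ r in a..b, -(h t r * U t r)) ^ 2 / m - Λ ^ 2 / a ^ 4 * m ≤ d := fun t ht' => by
      obtain ⟨i1, i2, i3⟩ := hsub t ht'
      exact hs.exists_deriv_neg_integral_momentum ha hab.le i1 hm0 (hUa t i2) (hUb t i2)
        (hha t i2 i3) (hhb t i2 i3) (hpos t i2) (hmass t i2) (hang t i2)
    choose! d hd1 hd2 using hd
    set K := Λ ^ 2 / a ^ 4 with hK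
    have hK0 : 0 ≤ K := by positivity
    have hKm : K * m ≤ K * x ^ 2 := mul_le_mul_of_nonneg_left hm hK0
    have hτ1 : τ ≤ 1 := (div_le_one hx).2 hyx
    have key := mul_lt_two_of_riccati (γ := K * m) (Y := c * x ^ 3 / 2) (α := 1 / m)
      (mul_nonneg hK0 hm0.le) (by positivity) (by positivity) hτ0.le
      ((hs.c1_h.mul hs.c1_U).neg.integral_slice ha hab.le hτ) hd1
      (fun t ht' => by rw [one_div_mul_eq_div]; exact hd2 t ht') (by linarith)
      (by
        have h1 : K * m * τ ≤ K * m := mul_le_of_le_one_right (mul_nonneg hK0 hm0.le) hτ1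
        have h2 := mul_le_mul_of_nonneg_right hx₁ (sq_nonneg x)
        linarith [show c * x * x ^ 2 = c * x ^ 3 by ring])
      (by
        rw [one_div_mul_eq_div, le_div_iff₀ hm0]
        have h1 : m * m ≤ x ^ 2 * x ^ 2 := mul_le_mul hm hm hm0.le (sq_nonneg x)
        have h2 := mul_le_mul_of_nonneg_left h1 hK0
        have h3 := mul_le_mul_of_nonneg_right hx₂ (mul_nonneg (sq_nonneg x) (sq_nonneg x))
        linarith [show (c * x ^ 3 / 2) ^ 2 = c ^ 2 * x ^ 2 * (x ^ 2 * x ^ 2) / 4 by ring])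
    have h1 : 1 / x ^ 2 ≤ 1 / m := one_div_le_one_div_of_le hm0 hm
    have h2 : 1 / x ^ 2 * (c * x ^ 3 / 2) * τ = c * y / 2 := by
      rw [hτ_def]
      field_simp
    have h3 : 1 / x ^ 2 * (c * x ^ 3 / 2) * τ ≤ 1 / m * (c * x ^ 3 / 2) * τ := by gcongr
    linarith
  -- Heavy case: half of `m² / b²` absorbs the negative terms, and `√(α γ) τ ≥ y / (2 b²) ≥ 4 ≥ π`.
  · have hd : ∀ t ∈ Ioo 0 τ, ∃ d, HasDerivAt (fun s => ∫ r in a..b, r * r * (h s r * U s r)) d t ∧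
        (∫ r in a..b, r * r * (h t r * U t r)) ^ 2 / (b ^ 2 * m) + m ^ 2 / b ^ 2
          - b ^ 2 * m / 4 - b ^ 2 * hbar ^ 2 / 2 ≤ d := fun t ht' => by
      obtain ⟨i1, i2, i3⟩ := hsub t ht'
      exact hs.exists_deriv_integral_sq_mul_momentum ha hab.le i1 hm0 (hUa t i2) (hUb t i2)
        (hha t i2 i3) (hhb t i2 i3) (hpos t i2) (hmass t i2)
    choose! d hd1 hd2 using hd
    have hγ : m ^ 2 / (2 * b ^ 2) ≤ m ^ 2 / b ^ 2 - b ^ 2 * m / 4 - b ^ 2 * hbar ^ 2 / 2 := by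
      have h1 : b ^ 4 * m ≤ m * m := mul_le_mul_of_nonneg_right (hx₃.trans hm) hm0.le
      have h2 : (2 * b ^ 2 * hbar) ^ 2 ≤ m ^ 2 :=
        pow_le_pow_left₀ (by positivity) (hx₄.trans hm) 2
      have h3 : 0 ≤ (2 * m ^ 2 - b ^ 4 * m - 2 * b ^ 4 * hbar ^ 2) / (4 * b ^ 2) := by
        refine div_nonneg ?_ (by positivity)
        have : 0 ≤ b ^ 4 * hbar ^ 2 := by positivity
        linarith [show (2 * b ^ 2 * hbar) ^ 2 = 4 * (b ^ 4 * hbar ^ 2) by ring]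
      have h4 : (2 * m ^ 2 - b ^ 4 * m - 2 * b ^ 4 * hbar ^ 2) / (4 * b ^ 2)
          = m ^ 2 / b ^ 2 - b ^ 2 * m / 4 - b ^ 2 * hbar ^ 2 / 2 - m ^ 2 / (2 * b ^ 2) := by
        field_simp
        ring
      linarith
    have key := sqrt_mul_lt_pi_of_riccati (α := 1 / (b ^ 2 * m)) (γ := m ^ 2 / (2 * b ^ 2))
      (by positivity) (by positivity) hτ0.le
      (((HasC1Derivs.radius.mul HasC1Derivs.radius).mul
        (hs.c1_h.mul hs.c1_U)).integral_slice ha hab.le hτ) hd1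
      (fun t ht' => by rw [one_div_mul_eq_div]; linarith [hd2 t ht'])
    have h1 : x / (2 * b ^ 2) ≤ √(1 / (b ^ 2 * m) * (m ^ 2 / (2 * b ^ 2))) := by
      refine Real.le_sqrt_of_sq_le ?_
      have e1 : 1 / (b ^ 2 * m) * (m ^ 2 / (2 * b ^ 2)) = 2 * m / (2 * b ^ 2) ^ 2 := by
        field_simp
      rw [e1, div_pow]
      gcongr
      linarith
    have h2 : x / (2 * b ^ 2) * τ = y / (2 * b ^ 2) := by
      rw [hτ_def]
      field_simp
    have h3 : 4 ≤ y / (2 * b ^ 2) := by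
      rw [le_div_iff₀ (by positivity)]
      linarith
    have h4 := mul_le_mul_of_nonneg_right h1 hτ0.le
    linarith [Real.pi_le_four]

/-- Lower bound for the inward momentum of the initial data. -/
theorem mul_halfLineNorm_one_le {h₀ U₀ : ℝ → ℝ} {a b β₁ β₂ hlow : ℝ} (ha : 0 < a) (haβ : a < β₁)
    (hβb : β₂ ≤ b) (hab : a ≤ b) (hh : ContinuousOn h₀ (Ioi 0)) (hU : ContinuousOn U₀ (Ioi 0))
    (hU0 : ∀ r, 0 < r → r ∉ Icc β₁ β₂ → U₀ r = 0) (hlow_le : ∀ r ∈ Icc β₁ β₂, hlow ≤ h₀ r)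
    (hUnp : ∀ r ∈ Icc β₁ β₂, U₀ r ≤ 0) :
    hlow * halfLineNorm 1 U₀ ≤ ∫ r in a..b, -(h₀ r * U₀ r) := by
  have hsub : Icc a b ⊆ Ioi 0 := fun r hr => ha.trans_le hr.1
  rw [halfLineNorm_one_eq ha.le hab hU fun r hr0 hr => hU0 r hr0 fun hrβ =>
    hr ⟨haβ.trans_le hrβ.1, hrβ.2.trans hβb⟩, ← intervalIntegral.integral_const_mul]
  refine intervalIntegral.integral_mono_on hab
    (((hU.mono hsub).abs.intervalIntegrable_of_Icc hab).const_mul hlow)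
    (((hh.mono hsub).mul (hU.mono hsub)).neg.intervalIntegrable_of_Icc hab) fun r hr => ?_
  by_cases hrβ : r ∈ Icc β₁ β₂
  · rw [abs_of_nonpos (hUnp r hrβ)]
    linarith [mul_le_mul_of_nonpos_right (hlow_le r hrβ) (hUnp r hrβ)]
  · simp [hU0 r (hsub hr) hrβ]

/-- Fixes the threshold `C`: every requirement on `x` and `y` holds for large `M`. Here `ε < 1/3`
sends the time `y / x` to zero and `ε > 0` lets `y` beat the constants. -/
theorem eventually_largeness (c K N β₁ hbar ε : ℝ) (hc : 0 < c) (hβ₁ : 0 < β₁)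
    (hε : 0 < ε) (hε' : ε < 1 / 3) :
    ∀ᶠ M : ℝ in Filter.atTop, 0 < M ∧ M ^ (-(1 / 3 : ℝ) + ε) ≤ 1 ∧
      (hbar + 2) * M ^ (-(1 / 3 : ℝ) + ε) < β₁ / 4 ∧ K ≤ c * M ^ (1 / 3 : ℝ) ∧
      K ≤ c ^ 2 * (M ^ (1 / 3 : ℝ)) ^ 2 ∧ K ≤ (M ^ (1 / 3 : ℝ)) ^ 2 ∧ 4 ≤ c * M ^ ε ∧
      N ≤ M ^ ε := by
  have tx := tendsto_rpow_atTop (y := 1 / 3) (by norm_num)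
  have tx2 := (Filter.tendsto_pow_atTop (α := ℝ) two_ne_zero).comp tx
  have ty := tendsto_rpow_atTop hε
  have tτ : Filter.Tendsto (fun M : ℝ => M ^ (-(1 / 3 : ℝ) + ε)) Filter.atTop (nhds 0) := by
    have := tendsto_rpow_neg_atTop (y := 1 / 3 - ε) (by linarith)
    rwa [show -(1 / 3 - ε) = -(1 / 3 : ℝ) + ε by ring] at this
  have tτ' := tτ.const_mul (hbar + 2)
  rw [mul_zero] at tτ'
  filter_upwards [Filter.eventually_gt_atTop 0, tτ.eventually_le_const one_pos,
    tτ'.eventually_lt_const (show (0 : ℝ) < β₁ / 4 by positivity),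
    (tx.const_mul_atTop hc).eventually_ge_atTop K,
    (tx2.const_mul_atTop (pow_pos hc 2)).eventually_ge_atTop K, tx2.eventually_ge_atTop K,
    (ty.const_mul_atTop hc).eventually_ge_atTop 4, ty.eventually_ge_atTop N]
    with M h1 h2 h3 h4 h5 h6 h7 h8
  exact ⟨h1, h2, h3, h4, h5, h6, h7, h8⟩

/-- Singularity formation for the radially symmetric rotating shallow water system: if the inward
initial velocity is large, every classical solution ceases to exist before the time
`2 ‖U₀‖_∞ ^ (-1/3 + ε)`; in particular there is no global classical solution. -/
theorem theorem1p2 (A hlow hbar B β₁ β₂ ε : ℝ)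
    (hA : 0 < A) (hhlow : 0 < hlow) (hhbar : 0 < hbar) (hβ₁ : 0 < β₁) (hβ₂ : 0 < β₂)
    (hε : 0 < ε) (hε' : ε < 1 / 3) :
    ∃ C : ℝ, 0 < C ∧ ∀ h₀ U₀ V₀ : ℝ → ℝ,
      IsInitialData hbar β₁ β₂ h₀ U₀ V₀ →
      (∀ r ∈ Icc β₁ β₂, hlow ≤ h₀ r) →
      (∀ r ∈ Icc β₁ β₂, U₀ r ≤ 0) →
      halfLineNorm ∞ V₀ ≤ B →
      halfLineNorm ∞ U₀ ≤ A * halfLineNorm 1 U₀ →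
      C ≤ halfLineNorm ∞ U₀ →
      ∀ (T : ℝ) (h U V : ℝ → ℝ → ℝ), IsClassicalSolution T h₀ U₀ V₀ h U V →
        T < 2 * halfLineNorm ∞ U₀ ^ (-(1 / 3 : ℝ) + ε) := by
  have hlowA : 0 < hlow / A := div_pos hhlow hA
  set a := β₁ / 2 with ha_def
  set b := 2 * β₂ with hb_def
  have ha : 0 < a := by positivity
  have hb : 0 < b := by positivity
  set Λ := b * B + b * b / 2 with hΛ_def
  set K := max (8 * (Λ ^ 2 / a ^ 4)) (max (b ^ 4) (2 * b ^ 2 * hbar)) with hK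
  obtain ⟨C, hC⟩ := Filter.eventually_atTop.1
    (eventually_largeness (hlow / A) K (8 * b ^ 2) β₁ hbar ε hlowA hβ₁ hε hε')
  refine ⟨max C 1, by positivity, fun h₀ U₀ V₀ hdata hlow_le hUnp hVB hUA hCM T h U V hsol => ?_⟩
  set M := halfLineNorm ∞ U₀ with hM
  obtain ⟨hM0, hτ1, hτβ, hx₁, hx₂, hx₃, hy₁, hy₂⟩ := hC M ((le_max_left _ _).trans hCM)
  -- Otherwise `U₀` vanishes identically, contradicting `M > 0`.
  have hβ : β₁ ≤ β₂ := by
    by_contra! hlt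
    have : halfLineNorm 1 U₀ = 0 := by
      rw [halfLineNorm_one_eq (a := 1) (b := 1) zero_le_one le_rfl
        hdata.contDiffOn_U.continuousOn fun r hr _ =>
          hdata.U_eq r hr (by simp [Icc_eq_empty hlt.not_ge])]
      simp
    rw [this, mul_zero] at hUA
    exact hUA.not_gt hM0
  have hab : a < b := by simp only [ha_def, hb_def]; linarith
  obtain ⟨ht, hr, Ut, Ur, Vt, Vr, hs⟩ := hsol.exists_isRotatingShallowWater
  set x := M ^ (1 / 3 : ℝ) with hx
  set y := M ^ ε with hy
  have hx0 : 0 < x := Real.rpow_pos_of_pos hM0 _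
  have hy0 : 0 < y := Real.rpow_pos_of_pos hM0 _
  have hτ : M ^ (-(1 / 3 : ℝ) + ε) = y / x := by
    rw [add_comm, ← sub_eq_add_neg, Real.rpow_sub hM0]
  have hx3 : x ^ 3 = M := by
    rw [hx, ← Real.rpow_natCast, ← Real.rpow_mul hM0.le]
    norm_num
  rw [hτ] at hτ1 hτβ ⊢
  have hτ0 : 0 < y / x := div_pos hy0 hx0
  have hrest : ∀ r, 0 < r → r ∉ Icc β₁ β₂ → h 0 r = hbar ∧ U 0 r = 0 ∧ V 0 r = 0 :=
    fun r hr0 hrβ => ⟨(hsol.initial_h r hr0).trans (hdata.h_eq r hr0 hrβ),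
      (hsol.initial_U r hr0).trans (hdata.U_eq r hr0 hrβ),
      (hsol.initial_V r hr0).trans (hdata.V_eq r hr0 hrβ)⟩
  -- The rest zones `(β₁ / 4, β₁)` and `(β₂, 3 * β₂)` lose less than `β₁ / 4` at each end, so they
  -- still contain `a = β₁ / 2` and `b = 2 * β₂`.
  have hspeed : ∀ t ∈ Icc 0 (y / x), (hbar + 2) * t < β₁ / 4 := fun t ht' =>
    (mul_le_mul_of_nonneg_left ht'.2 (by positivity)).trans_lt hτβ
  have hrest_a : ∀ t ∈ Icc 0 (y / x), t < T → h t a = hbar ∧ U t a = 0 ∧ V t a = 0 :=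
    fun t ht' htT => hs.rest_of_rest_initially (R₁ := β₁ / 4) (R₂ := β₁) hhbar (by positivity)
      (by linarith) (fun r hr1 hr2 => hrest r (by linarith) fun hrβ => hr2.not_ge hrβ.1)
      t ⟨ht'.1, htT⟩ a (by linarith [hspeed t ht']) (by linarith [hspeed t ht'])
  have hrest_b : ∀ t ∈ Icc 0 (y / x), t < T → h t b = hbar ∧ U t b = 0 ∧ V t b = 0 :=
    fun t ht' htT => hs.rest_of_rest_initially (R₁ := β₂) (R₂ := 3 * β₂) hhbar hβ₂
      (by linarith) (fun r hr1 hr2 => hrest r (by linarith) fun hrβ => hr1.not_ge hrβ.2)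
      t ⟨ht'.1, htT⟩ b (by linarith [hspeed t ht']) (by linarith [hspeed t ht'])
  have hVpt := abs_le_halfLineNorm_top hβ₁ hdata.contDiffOn_V.continuousOn hdata.V_eq
  have hK₁ : 8 * (Λ ^ 2 / a ^ 4) ≤ K := le_max_left _ _
  have hK₂ : b ^ 4 ≤ K := (le_max_left _ _).trans (le_max_right _ _)
  have hK₃ : 2 * b ^ 2 * hbar ≤ K := (le_max_right _ _).trans (le_max_right _ _)
  have hΛ0 : 0 ≤ Λ ^ 2 / a ^ 4 := by positivity
  have hmom : hlow / A * x ^ 3 ≤ ∫ r in a..b, -(h 0 r * U 0 r) := by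
    have h1 := mul_halfLineNorm_one_le ha (b := b) (by linarith) (by linarith) hab.le
      hdata.contDiffOn_h.continuousOn hdata.contDiffOn_U.continuousOn hdata.U_eq hlow_le hUnp
    have h2 : ∫ r in a..b, -(h 0 r * U 0 r) = ∫ r in a..b, -(h₀ r * U₀ r) := by
      refine intervalIntegral.integral_congr fun r hrab => ?_
      rw [uIcc_of_le hab.le] at hrab
      simp only [hsol.initial_h r (ha.trans_le hrab.1), hsol.initial_U r (ha.trans_le hrab.1)]
    have h3 : hlow / A * M ≤ hlow * halfLineNorm 1 U₀ := by
      rw [div_mul_eq_mul_div, div_le_iff₀ hA]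
      linarith [mul_le_mul_of_nonneg_left hUA hhlow.le]
    rw [h2, hx3]
    exact h3.trans h1
  have hlife := hs.lifespan_le (Λ := Λ) ha hab hhbar hlowA hx0 hy0
    (fun t ht' htT => (hrest_a t ht' htT).2.1) (fun t ht' htT => (hrest_b t ht' htT).2.1)
    (fun t ht' htT => (hrest_a t ht' htT).1) (fun t ht' htT => (hrest_b t ht' htT).1)
    (fun r hrab => by
      have hr0 : 0 < r := ha.trans_le hrab.1
      rw [hsol.initial_h r hr0]
      by_cases hrβ : r ∈ Icc β₁ β₂
      · exact hhlow.trans_le (hlow_le r hrβ)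
      · rwa [hdata.h_eq r hr0 hrβ])
    (fun r hrab => by
      have hr0 : 0 < r := ha.trans_le hrab.1
      rw [hsol.initial_V r hr0]
      calc |r * V₀ r + r * r / 2| ≤ |r * V₀ r| + |r * r / 2| := abs_add_le _ _
        _ = r * |V₀ r| + r * r / 2 := by
          rw [abs_mul, abs_of_pos hr0, abs_of_pos (by positivity : 0 < r * r / 2)]
        _ ≤ b * B + b * b / 2 := by
          have := hrab.2
          have := (hVpt r hr0).trans hVB
          gcongr)
    hmom ((div_le_one hx0).1 hτ1) (by linarith) (by linarith) (by linarith) (by linarith) hy₁ hy₂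
  linarith
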